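/- Let $SG_{2,4}(n)$, $n\ge 0$, be the two-dimensional generalized Sierpinski gasket graphs of side length $4$: $SG_{2,4}(0)$ is a triangle (three vertices, pairwise adjacent), and $SG_{2,4}(n+1)$ is obtained by arranging ten copies of $SG_{2,4}(n)$ as the upward triangles (in four layers, of $4,3,2,1$ triangles) of a triangle of four times the side length and identifying the corner vertices that coincide. For a finite graph $G$ let $v(G)$ be its number of vertices and let $N_{SF}(G)$ be its number of spanning forests, that is, of acyclic subgraphs containing all vertices of $G$. Then $v(SG_{2,4}(n))\to\infty$, the asymptotic growth constant $$z_{SG_{2,4}}=\lim_{n\to\infty}\frac{\ln N_{SF}(SG_{2,4}(n))}{v(SG_{2,4}(n))}$$ exists, and $z_{SG_{2,4}}=1.36051646575\ldots$, that is, $1.36051646575\le z_{SG_{2,4}}<1.36051646576$. -/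

import Mathlib

open Filter Topology

/-- The number of spanning forests of a graph `G`: the number of spanning subgraphs of `G`
(all vertices are kept, any set of edges is chosen) without cycles. -/
noncomputable def numSpanningForests {V : Type*} (G : SimpleGraph V) : ℕ :=
  Nat.card {H : SimpleGraph V // H ≤ G ∧ H.IsAcyclic}

/-- `z` is the asymptotic growth constant for the number of spanning forests along a sequence of
finite graphs `G n`: the number of vertices `v(G n)` tends to infinity and
`ln N_SF(G n) / v(G n)` tends to `z`. -/
def HasForestGrowthConstant {V : ℕ → Type*} [∀ n, Fintype (V n)]
    (G : ∀ n, SimpleGraph (V n)) (z : ℝ) : Prop :=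
  Tendsto (fun n => Fintype.card (V n)) atTop atTop ∧
    Tendsto (fun n => Real.log (numSpanningForests (G n)) / (Fintype.card (V n) : ℝ)) atTop (𝓝 z)

namespace SierpinskiGasket

/-! Points of the triangular lattice are given by their (oblique) coordinates `(i, j)`, standing for
`i • e₁ + j • e₂` with unit vectors `e₁, e₂` at an angle of 60 degrees. Stage `n` fills the
upward triangle with corners `(0, 0)`, `(b ^ n, 0)`, `(0, b ^ n)`. -/

/-- The three corners of the unit triangle. -/
def unitTriangle : Finset (ℕ × ℕ) := {(0, 0), (1, 0), (0, 1)}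

/-- The positions of the `b (b + 1) / 2` upward triangles, in `b` layers, of which a triangle of
side length `b` is built. -/
def cells (b : ℕ) : Finset (ℕ × ℕ) :=
  (Finset.range b ×ˢ Finset.range b).filter fun c => c.1 + c.2 < b

/-- Vertices of the two-dimensional gasket with side length `b`: stage `0` is a triangle, and stage
`n + 1` is the union of the translates of stage `n` by `b ^ n • c`, for `c` in `cells b`. -/
def vertices (b : ℕ) : ℕ → Finset (ℕ × ℕ)
  | 0 => unitTriangle
  | n + 1 => (cells b).biUnion fun c => (vertices b n).image fun p => b ^ n • c + p

/-- Edges of the gasket: stage `0` has the three edges of the triangle, and the edges of stage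
`n + 1` are the translates of those of stage `n` by `b ^ n • c`, for `c` in `cells b`. -/
def Edge (b : ℕ) : ℕ → ℕ × ℕ → ℕ × ℕ → Prop
  | 0, p, q => p ∈ unitTriangle ∧ q ∈ unitTriangle ∧ p ≠ q
  | n + 1, p, q => ∃ c ∈ cells b, ∃ p' q' : ℕ × ℕ,
      Edge b n p' q' ∧ p = b ^ n • c + p' ∧ q = b ^ n • c + q'

theorem Edge.symm {b n : ℕ} {p q : ℕ × ℕ} (h : Edge b n p q) : Edge b n q p := by
  induction n generalizing p q with
  | zero => exact ⟨h.2.1, h.1, h.2.2.symm⟩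
  | succ n ih =>
    obtain ⟨c, hc, p', q', h', hp, hq⟩ := h
    exact ⟨c, hc, q', p', ih h', hq, hp⟩

theorem Edge.ne {b n : ℕ} {p q : ℕ × ℕ} (h : Edge b n p q) : p ≠ q := by
  induction n generalizing p q with
  | zero => exact h.2.2
  | succ n ih =>
    obtain ⟨c, -, p', q', h', rfl, rfl⟩ := h
    exact fun he => ih h' (add_left_cancel he)

/-- The two-dimensional generalized Sierpinski gasket `SG_{2,b}(n)` at stage `n`. -/
def graph (b n : ℕ) : SimpleGraph {p : ℕ × ℕ // p ∈ vertices b n} where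
  Adj p q := Edge b n p.1 q.1
  symm := ⟨fun _ _ h => h.symm⟩
  loopless := ⟨fun _ h => h.ne rfl⟩

end SierpinskiGasket

/-! Over the field of two elements, give the edge `uv` the vector `u + v`. A set of edges is a
forest exactly when its vectors are independent, so spanning forests become independent subsets
(`numSpanningForests_ofList`). A copy of a gasket meets the rest of the graph only in its three
corners, and vectors of the copy interact with vectors outside only through the plane of even
combinations of these corners. That plane has five subspaces, matching the five partitions of three
points. Hence five numbers `weights n`, counting the forests of stage `n` by the partition they
induce on the corners, determine those of stage `n + 1` (`indepSum_eq_sum_triangleCount`,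
`indepSum_glueEdges`, `weights_succ`): glue ten triangles, each with a weighted choice of partition,
without closing a cycle.

Let `S n` be the sum of the five weights, which is the number of forests, and let `weights n 0`
count the forests separating all three corners. A forest restricts to forests of the ten copies, so
`S (n + 1) ≤ S n ^ 10`. Corner-separating forests of the copies always combine to a
corner-separating forest, so `weights n 0 ^ 10 ≤ weights (n + 1) 0`. Therefore `log (S n) / 10 ^ n`
decreases, `log (weights n 0) / 10 ^ n` increases and stays below it, and the limit of the former
lies between any two values of these sequences.

At `n = 3` the two values already differ by less than `10 ^ (-12)`. The recursion is evaluated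
exactly up to this stage, and Taylor bounds for `exp` enclose the two logarithms. Since `3 * v = 4 *
10 ^ n + 5` for the number `v` of vertices, the growth constant is `3 / 4` of the limit. -/

/-! ### Weighted sums over independent subsets, by deletion and contraction. -/

open Classical in
/-- The sum of `φ (U ⊔ span A)` over the sublists `A` of a list of vectors that are linearly
independent modulo `U`. -/
noncomputable def indepSum {K M : Type*} [DivisionRing K] [AddCommGroup M] [Module K M]
    (φ : Submodule K M → ℕ) : List M → Submodule K M → ℕ
  | [], U => φ U
  | e :: es, U => indepSum φ es U + if e ∈ U then 0 else indepSum φ es (U ⊔ K ∙ e)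

namespace indepSum

section DivisionRing

variable {K M N : Type*} [DivisionRing K] [AddCommGroup M] [Module K M] [AddCommGroup N]
  [Module K N]

theorem append (φ : Submodule K M → ℕ) (as bs : List M) (U : Submodule K M) :
    indepSum φ (as ++ bs) U = indepSum (indepSum φ bs) as U := by
  induction as generalizing U with
  | nil => rfl
  | cons e es ih => simp only [List.cons_append, indepSum, ih]

theorem congr {φ ψ : Submodule K M → ℕ} {Y : Submodule K M} (h : ∀ W ≤ Y, φ W = ψ W)
    {es : List M} (hes : ∀ e ∈ es, e ∈ Y) {U : Submodule K M} (hU : U ≤ Y) :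
    indepSum φ es U = indepSum ψ es U := by
  induction es generalizing U with
  | nil => exact h U hU
  | cons e es ih =>
    have h1 := ih (fun x hx => hes x (List.mem_cons_of_mem _ hx)) hU
    have h2 := ih (fun x hx => hes x (List.mem_cons_of_mem _ hx)) (U := U ⊔ K ∙ e)
      (sup_le hU ((Submodule.span_singleton_le_iff_mem _ _).2 (hes e List.mem_cons_self)))
    simp only [indepSum, h1, h2]

theorem zero (es : List M) (U : Submodule K M) : indepSum (fun _ => 0) es U = 0 := by
  induction es generalizing U with
  | nil => rfl
  | cons e es ih => simp [indepSum, ih]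

theorem add (φ ψ : Submodule K M → ℕ) (es : List M) (U : Submodule K M) :
    indepSum (fun W => φ W + ψ W) es U = indepSum φ es U + indepSum ψ es U := by
  induction es generalizing U with
  | nil => rfl
  | cons e es ih =>
    simp only [indepSum, ih]
    split_ifs <;> ring

theorem mul_const (φ : Submodule K M → ℕ) (c : ℕ) (es : List M) (U : Submodule K M) :
    indepSum (fun W => φ W * c) es U = indepSum φ es U * c := by
  induction es generalizing U with
  | nil => rfl
  | cons e es ih =>
    simp only [indepSum, ih]
    split_ifs <;> ring

theorem sum {ι : Type*} (s : Finset ι) (φ : ι → Submodule K M → ℕ) (es : List M)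
    (U : Submodule K M) :
    indepSum (fun W => ∑ i ∈ s, φ i W) es U = ∑ i ∈ s, indepSum (φ i) es U := by
  classical
  induction s using Finset.induction_on with
  | empty => simp [zero]
  | insert i s hi ih => simp only [Finset.sum_insert hi, add, ih]

-- Adjoining a vector of `X` commutes with intersecting with `X`, by the modular law, so a weight
-- that sees only the trace on `X` keeps this property.
open Classical in
theorem inf_right {φ : Submodule K M → ℕ} {X : Submodule K M} (hφ : ∀ U, φ U = φ (U ⊓ X))
    {es : List M} (hes : ∀ e ∈ es, e ∈ X) (U : Submodule K M) :
    indepSum φ es U = indepSum φ es (U ⊓ X) := by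
  induction es generalizing U with
  | nil => exact hφ U
  | cons e es ih =>
    have he : e ∈ X := hes e List.mem_cons_self
    have ih := ih fun x hx => hes x (List.mem_cons_of_mem _ hx)
    have h : (U ⊔ K ∙ e) ⊓ X = U ⊓ X ⊔ K ∙ e := by
      rw [sup_comm, sup_inf_assoc_of_le _ ((Submodule.span_singleton_le_iff_mem _ _).2 he),
        sup_comm]
    have hm : e ∈ U ↔ e ∈ U ⊓ X := by simp [he]
    simp only [indepSum, ih U, ih (U ⊔ K ∙ e), h]
    rw [if_congr hm rfl rfl]

open Classical in
theorem map (f : M →ₗ[K] N) (hf : Function.Injective f) (φ : Submodule K N → ℕ) (es : List M)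
    (U : Submodule K M) :
    indepSum φ (es.map f) (U.map f) = indepSum (fun W => φ (W.map f)) es U := by
  induction es generalizing U with
  | nil => rfl
  | cons e es ih =>
    have h : U.map f ⊔ K ∙ f e = (U ⊔ K ∙ e).map f := by
      rw [Submodule.map_sup, Submodule.map_span, Set.image_singleton]
    have h' : f e ∈ U.map f ↔ e ∈ U := by
      simp [Submodule.mem_map, hf.eq_iff]
    simp only [indepSum, List.map_cons, h, ih]
    rw [if_congr h' rfl rfl]

theorem disjoint_sup_span_iff {U W : Submodule K M} (h : Disjoint U W) {e : M} (he : e ∉ W) :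
    Disjoint U (W ⊔ K ∙ e) ↔ e ∉ U ⊔ W := by
  constructor
  · intro hd hm
    obtain ⟨u, hu, w, hw, rfl⟩ := Submodule.mem_sup.1 hm
    have : u ∈ W ⊔ K ∙ (u + w) := by
      have := Submodule.add_mem_sup (neg_mem hw) (Submodule.mem_span_singleton_self (R := K) (u + w))
      rwa [add_comm u, neg_add_cancel_left, add_comm w] at this
    have hu0 := Submodule.disjoint_def.1 hd u hu this
    exact he (by simpa [hu0] using hw)
  · intro hm
    refine h.disjoint_sup_right_of_disjoint_sup_left ?_
    rw [Submodule.disjoint_span_singleton]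
    exact fun h => absurd h hm

open Classical in
theorem of_not_disjoint (φ : Submodule K M → ℕ) {U W : Submodule K M} (h : ¬ Disjoint U W)
    (es : List M) :
    indepSum (fun W' => if Disjoint U W' then φ W' else 0) es W = 0 := by
  induction es generalizing W with
  | nil => simp [indepSum, h]
  | cons e es ih =>
    have h' : ¬ Disjoint U (W ⊔ K ∙ e) := fun hd => h (hd.mono_right le_sup_left)
    simp [indepSum, ih h, ih h']

-- Independence modulo `U ⊔ W` is independence modulo `W` together with disjointness of the
-- resulting span from `U`. Once disjointness is lost it never returns, so testing it at the end is
-- enough.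
open Classical in
theorem sup_eq (φ : Submodule K M → ℕ) {U W : Submodule K M} (h : Disjoint U W) (es : List M) :
    indepSum φ es (U ⊔ W) =
      indepSum (fun W' => if Disjoint U W' then φ (U ⊔ W') else 0) es W := by
  induction es generalizing W with
  | nil => simp [indepSum, h]
  | cons e es ih =>
    simp only [indepSum, ih h]
    congr 1
    by_cases he : e ∈ W
    · simp [he, Submodule.mem_sup_right he]
    · by_cases heU : e ∈ U ⊔ W
      · rw [if_pos heU, if_neg he, of_not_disjoint]
        rwa [disjoint_sup_span_iff h he, not_not]
      · rw [if_neg heU, if_neg he, sup_assoc, ih]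
        rwa [disjoint_sup_span_iff h he]

open Classical in
theorem eq_bot (φ : Submodule K M → ℕ) (U : Submodule K M) (es : List M) :
    indepSum φ es U =
      indepSum (fun W => if Disjoint U W then φ (U ⊔ W) else 0) es ⊥ := by
  rw [← sup_eq φ disjoint_bot_right, sup_bot_eq]

end DivisionRing

end indepSum

/-! ### Gluing along a plane over the field of two elements. -/

section Triangle

variable {M N : Type*} [AddCommGroup M] [Module (ZMod 2) M] [AddCommGroup N] [Module (ZMod 2) N]

open Submodule

/-- The subspaces of a plane over the field of two elements with basis `x`, `y`. They correspond to
the partitions of the three vertices of a triangle with edge vectors `x`, `y` and `x + y`. -/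
def triangleSpan (x y : M) : Fin 5 → Submodule (ZMod 2) M :=
  ![⊥, ZMod 2 ∙ x, ZMod 2 ∙ y, ZMod 2 ∙ (x + y), span (ZMod 2) {x, y}]

open Classical in
/-- The index of the trace of a subspace on the plane spanned by `x` and `y`. -/
noncomputable def triangleIndex (x y : M) (W : Submodule (ZMod 2) M) : Fin 5 :=
  if x ∈ W then if y ∈ W then 4 else 1 else if y ∈ W then 2 else if x + y ∈ W then 3 else 0

theorem mem_span_pair_zmod_two {x y z : M} :
    z ∈ span (ZMod 2) {x, y} ↔ z = 0 ∨ z = x ∨ z = y ∨ z = x + y := by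
  rw [mem_span_pair]
  constructor
  · rintro ⟨a, b, rfl⟩
    obtain rfl | rfl : a = 0 ∨ a = 1 := by revert a; decide
    all_goals obtain rfl | rfl : b = 0 ∨ b = 1 := by revert b; decide
    all_goals simp
  · rintro (rfl | rfl | rfl | rfl)
    · exact ⟨0, 0, by simp⟩
    · exact ⟨1, 0, by simp⟩
    · exact ⟨0, 1, by simp⟩
    · exact ⟨1, 1, by simp⟩

theorem mem_span_singleton_zmod_two {x z : M} : z ∈ ZMod 2 ∙ x ↔ z = 0 ∨ z = x := by
  rw [mem_span_singleton]
  constructor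
  · rintro ⟨a, rfl⟩
    obtain rfl | rfl : a = 0 ∨ a = 1 := by revert a; decide
    all_goals simp
  · rintro (rfl | rfl)
    · exact ⟨0, by simp⟩
    · exact ⟨1, by simp⟩

/-- The nonzero vectors of the plane are among `x`, `y`, `x + y`, and any two of these sum to the
third; so membership of these three determines the trace and only five cases occur. -/
theorem inf_span_pair (x y : M) (W : Submodule (ZMod 2) M) :
    W ⊓ span (ZMod 2) {x, y} = triangleSpan x y (triangleIndex x y W) := by
  have h1 : x ∈ W → x + y ∈ W → y ∈ W := fun h h' => (W.add_mem_iff_right h).1 h'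
  have h2 : y ∈ W → x + y ∈ W → x ∈ W := fun h h' => (W.add_mem_iff_left h).1 h'
  have h3 : x ∈ W → y ∈ W → x + y ∈ W := W.add_mem
  ext z
  rw [mem_inf, mem_span_pair_zmod_two, triangleIndex]
  have h0 := W.zero_mem
  split_ifs with hx hy hy hxy <;>
  · simp only [triangleSpan, Matrix.cons_val, Matrix.cons_val_zero, Matrix.cons_val_one, Submodule.mem_bot,
      mem_span_singleton_zmod_two, mem_span_pair_zmod_two]
    constructor
    · rintro ⟨hz, rfl | rfl | rfl | rfl⟩ <;> simp_all
    · intro hz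
      constructor
      · rcases hz with rfl | rfl | rfl | rfl <;> simp_all
      · tauto

open Classical in
theorem triangleIndex_map (f : M →ₗ[ZMod 2] N) (hf : Function.Injective f) (x y : M)
    (W : Submodule (ZMod 2) M) :
    triangleIndex (f x) (f y) (W.map f) = triangleIndex x y W := by
  have h (z : M) : f z ∈ W.map f ↔ z ∈ W := by simp [Submodule.mem_map, hf.eq_iff]
  rw [triangleIndex, ← map_add]
  exact if_congr (h _) (if_congr (h _) rfl rfl) (if_congr (h _) rfl (if_congr (h _) rfl rfl))

open Classical in
theorem triangleIndex_inf {x y : M} {X : Submodule (ZMod 2) M} (hx : x ∈ X) (hy : y ∈ X)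
    (W : Submodule (ZMod 2) M) :
    triangleIndex x y (W ⊓ X) = triangleIndex x y W := by
  have h {z : M} (hz : z ∈ X) : z ∈ W ⊓ X ↔ z ∈ W := by simp [hz]
  exact if_congr (h hx) (if_congr (h hy) rfl rfl)
    (if_congr (h hy) rfl (if_congr (h (X.add_mem hx hy)) rfl rfl))

open Classical in
/-- The number of independent sublists of a list of vectors whose span has a given trace on the
plane spanned by `x` and `y`. -/
noncomputable def triangleCount (x y : M) (es : List M) (i : Fin 5) : ℕ :=
  indepSum (K := ZMod 2) (fun W => if triangleIndex x y W = i then 1 else 0) es ⊥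

theorem triangleCount_map (f : M →ₗ[ZMod 2] N) (hf : Function.Injective f) (x y : M)
    (es : List M) (i : Fin 5) :
    triangleCount (f x) (f y) (es.map f) i = triangleCount x y es i := by
  have := indepSum.map f hf (fun W => if triangleIndex (f x) (f y) W = i then 1 else 0) es ⊥
  rw [Submodule.map_bot] at this
  simp only [triangleCount, this, triangleIndex_map f hf]

theorem sum_triangleCount (x y : M) (es : List M) :
    ∑ i, triangleCount x y es i = indepSum (K := ZMod 2) (fun _ => 1) es ⊥ := by
  simp only [triangleCount, ← indepSum.sum]
  simp

open Classical in
/-- Gluing along a triangle: vectors that meet the rest only in the plane spanned by `x` and `y`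
contribute through their trace on this plane. -/
theorem indepSum_eq_sum_triangleCount {φ : Submodule (ZMod 2) M → ℕ} {X Y : Submodule (ZMod 2) M}
    {x y : M} (hφ : ∀ U, φ U = φ (U ⊓ X)) (hXY : X ⊓ Y = span (ZMod 2) {x, y})
    {U : Submodule (ZMod 2) M} (hU : U ≤ X) {es : List M} (hes : ∀ e ∈ es, e ∈ Y) :
    indepSum φ es U = ∑ i, triangleCount x y es i *
      if Disjoint U (triangleSpan x y i) then φ (U ⊔ triangleSpan x y i) else 0 := by
  rw [indepSum.eq_bot]
  -- As `U ≤ X`, both disjointness from `U` and the trace of `U ⊔ W` on `X` depend on `W` only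
  -- through `W ⊓ X`, a subspace of the plane.
  have key : ∀ W ≤ Y, (if Disjoint U W then φ (U ⊔ W) else 0) =
      ∑ i, (if triangleIndex x y W = i then 1 else 0) *
        if Disjoint U (triangleSpan x y i) then φ (U ⊔ triangleSpan x y i) else 0 := by
    intro W hW
    have hWX : W ⊓ X = triangleSpan x y (triangleIndex x y W) := by
      rw [← inf_span_pair, ← hXY, inf_comm X, ← inf_assoc, inf_eq_left.2 hW]
    have h1 : Disjoint U W ↔ Disjoint U (triangleSpan x y (triangleIndex x y W)) := by
      rw [← hWX, disjoint_iff, disjoint_iff, inf_comm W, ← inf_assoc, inf_eq_left.2 hU]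
    have h2 : φ (U ⊔ W) = φ (U ⊔ triangleSpan x y (triangleIndex x y W)) := by
      rw [hφ, sup_inf_assoc_of_le _ hU, hWX]
    rw [if_congr h1 h2 rfl]
    simp only [ite_mul, one_mul, zero_mul, Finset.sum_ite_eq, Finset.mem_univ, if_true]
  rw [indepSum.congr key hes bot_le, indepSum.sum]
  simp only [indepSum.mul_const]
  rfl

end Triangle

/-! ### The graphic matroid: spanning forests as independent sets of edge vectors. -/

/-- The vector of an edge in the graphic matroid over the field of two elements. -/
noncomputable def edgeVec {V : Type*} (e : V × V) : V →₀ ZMod 2 :=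
  Finsupp.single e.1 1 + Finsupp.single e.2 1

section EdgeVec

variable {V W : Type*}

theorem zmod_two_add_self {M : Type*} [AddCommGroup M] [Module (ZMod 2) M] (x : M) :
    x + x = 0 := by
  have : (2 : ZMod 2) • x = 0 := by rw [show (2 : ZMod 2) = 0 from rfl, zero_smul]
  rwa [two_smul] at this

theorem edgeVec_self (u : V) : edgeVec (u, u) = 0 := zmod_two_add_self _

theorem edgeVec_comm (u v : V) : edgeVec (u, v) = edgeVec (v, u) := add_comm _ _

theorem edgeVec_add_edgeVec (u v w : V) : edgeVec (u, v) + edgeVec (v, w) = edgeVec (u, w) := by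
  simp only [edgeVec]
  rw [add_assoc, ← add_assoc (Finsupp.single v 1), zmod_two_add_self, zero_add]

theorem edgeVec_eq_zero_iff {u v : V} : edgeVec (u, v) = 0 ↔ u = v := by
  constructor
  · intro h
    by_contra hne
    have := DFunLike.congr_fun h u
    simp [edgeVec, Ne.symm hne] at this
  · rintro rfl
    exact edgeVec_self u

theorem lmapDomain_edgeVec (f : V → W) (e : V × V) :
    Finsupp.lmapDomain (ZMod 2) (ZMod 2) f (edgeVec e) = edgeVec (Prod.map f f e) := by
  simp [edgeVec, Finsupp.mapDomain_add, Finsupp.mapDomain_single]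

theorem edgeVec_mem_ker_lmapDomain {l : V → W} {u v : V} :
    edgeVec (u, v) ∈ LinearMap.ker (Finsupp.lmapDomain (ZMod 2) (ZMod 2) l) ↔ l u = l v := by
  rw [LinearMap.mem_ker, lmapDomain_edgeVec]
  exact edgeVec_eq_zero_iff

end EdgeVec

namespace SimpleGraph

variable {V : Type*}

/-- The span of the vectors of the edges of a graph. -/
noncomputable def edgeSpan (G : SimpleGraph V) : Submodule (ZMod 2) (V →₀ ZMod 2) :=
  Submodule.span (ZMod 2) {x | ∃ u v, G.Adj u v ∧ x = edgeVec (u, v)}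

theorem edgeSpan_bot : (⊥ : SimpleGraph V).edgeSpan = ⊥ := by
  simp [edgeSpan]

/-- Pushing vertices forward to connected components kills the span of the edges but no vector of a
pair in different components. Conversely, edge vectors telescope along a path. -/
theorem edgeVec_mem_edgeSpan_iff {G : SimpleGraph V} {u v : V} :
    edgeVec (u, v) ∈ G.edgeSpan ↔ G.Reachable u v := by
  constructor
  · intro h
    have hle : G.edgeSpan ≤
        LinearMap.ker (Finsupp.lmapDomain (ZMod 2) (ZMod 2) G.connectedComponentMk) := by
      rw [edgeSpan, Submodule.span_le]
      rintro _ ⟨a, b, hab, rfl⟩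
      exact edgeVec_mem_ker_lmapDomain.2 (ConnectedComponent.sound hab.reachable)
    exact ConnectedComponent.exact (edgeVec_mem_ker_lmapDomain.1 (hle h))
  · rintro ⟨p⟩
    induction p with
    | nil => rw [edgeVec_self]; exact zero_mem _
    | cons h p ih =>
      rw [← edgeVec_add_edgeVec]
      exact add_mem (Submodule.subset_span ⟨_, _, h, rfl⟩) ih

theorem edgeSpan_sup_edge (G : SimpleGraph V) {u v : V} (h : u ≠ v) :
    (G ⊔ edge u v).edgeSpan = G.edgeSpan ⊔ ZMod 2 ∙ edgeVec (u, v) := by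
  have : {x : V →₀ ZMod 2 | ∃ a b, (G ⊔ edge u v).Adj a b ∧ x = edgeVec (a, b)} =
      {x | ∃ a b, G.Adj a b ∧ x = edgeVec (a, b)} ∪ {edgeVec (u, v)} := by
    ext x
    simp only [Set.mem_ofPred_eq, sup_adj, edge_adj, Set.mem_union, Set.mem_singleton_iff]
    constructor
    · rintro ⟨a, b, hab | ⟨⟨rfl, rfl⟩ | ⟨rfl, rfl⟩, -⟩, rfl⟩
      · exact Or.inl ⟨a, b, hab, rfl⟩
      · exact Or.inr rfl
      · exact Or.inr (edgeVec_comm _ _)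
    · rintro (⟨a, b, hab, rfl⟩ | rfl)
      · exact ⟨a, b, Or.inl hab, rfl⟩
      · exact ⟨u, v, Or.inr ⟨Or.inl ⟨rfl, rfl⟩, h⟩, rfl⟩
  rw [edgeSpan, this, Submodule.span_union]
  rfl

/-- The graph with a given list of edges. -/
def ofList (es : List (V × V)) : SimpleGraph V :=
  fromEdgeSet {e | e ∈ es.map Sym2.mk.uncurry}

theorem ofList_cons (u v : V) (es : List (V × V)) :
    ofList ((u, v) :: es) = edge u v ⊔ ofList es := by
  ext a b
  simp only [ofList, fromEdgeSet_adj, sup_adj, edge, Set.mem_ofPred_eq, List.map_cons,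
    List.mem_cons, Set.mem_singleton_iff, Function.uncurry_apply_pair]
  tauto

/-- Deletion–contraction in the same form as `indepSum`: `K` collects the edges already chosen, and
its edge span is the current subspace. Finiteness is carried along because `ncard` is additive only
for finite sets. -/
theorem finite_and_ncard_acyclic_between (es : List (V × V)) (hes : ∀ e ∈ es, e.1 ≠ e.2)
    (hnd : (es.map Sym2.mk.uncurry).Nodup) (K : SimpleGraph V) (hK : K.IsAcyclic)
    (hd : ∀ e ∈ es, ¬ K.Adj e.1 e.2) :
    {H : SimpleGraph V | K ≤ H ∧ H ≤ K ⊔ ofList es ∧ H.IsAcyclic}.Finite ∧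
    {H : SimpleGraph V | K ≤ H ∧ H ≤ K ⊔ ofList es ∧ H.IsAcyclic}.ncard =
      indepSum (fun _ => 1) (es.map edgeVec) K.edgeSpan := by
  induction es generalizing K with
  | nil =>
    have h0 : ofList ([] : List (V × V)) = ⊥ := by ext; simp [ofList]
    have : {H : SimpleGraph V | K ≤ H ∧ H ≤ K ⊔ ofList [] ∧ H.IsAcyclic} = {K} := by
      ext H
      simp only [h0, sup_bot_eq, Set.mem_ofPred_eq, Set.mem_singleton_iff]
      constructor
      · rintro ⟨h1, h2, -⟩
        exact le_antisymm h2 h1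
      · rintro rfl
        exact ⟨le_rfl, le_rfl, hK⟩
    rw [this]
    simp [indepSum]
  | cons e es ih =>
    obtain ⟨u, v⟩ := e
    have huv : u ≠ v := hes (u, v) List.mem_cons_self
    have hKuv : ¬ K.Adj u v := hd (u, v) List.mem_cons_self
    rw [List.map_cons, List.nodup_cons] at hnd
    have hes' : ∀ e ∈ es, e.1 ≠ e.2 := fun e he => hes e (List.mem_cons_of_mem _ he)
    have hd' : ∀ e ∈ es, ¬ K.Adj e.1 e.2 := fun e he => hd e (List.mem_cons_of_mem _ he)
    have huves : ¬ (ofList es).Adj u v := fun h => hnd.1 h.1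
    have hsplit : {H : SimpleGraph V | K ≤ H ∧ H ≤ K ⊔ ofList ((u, v) :: es) ∧ H.IsAcyclic} =
        {H | K ≤ H ∧ H ≤ K ⊔ ofList es ∧ H.IsAcyclic} ∪
        {H | K ⊔ edge u v ≤ H ∧ H ≤ K ⊔ edge u v ⊔ ofList es ∧ H.IsAcyclic} := by
      ext H
      simp only [ofList_cons, Set.mem_ofPred_eq, Set.mem_union, ← sup_assoc]
      constructor
      · rintro ⟨h1, h2, h3⟩
        by_cases hH : H.Adj u v
        · exact Or.inr ⟨sup_le h1 ((edge_le_iff _).2 (Or.inr hH)), h2, h3⟩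
        · refine Or.inl ⟨h1, fun a b hab => ?_, h3⟩
          have := h2 hab
          simp only [sup_adj, edge_adj] at this ⊢
          rcases this with (h | ⟨⟨rfl, rfl⟩ | ⟨rfl, rfl⟩, -⟩) | h
          · exact Or.inl h
          · exact absurd hab hH
          · exact absurd hab.symm hH
          · exact Or.inr h
      · rintro (⟨h1, h2, h3⟩ | ⟨h1, h2, h3⟩)
        · exact ⟨h1, h2.trans (sup_le_sup_right le_sup_left _), h3⟩
        · exact ⟨le_sup_left.trans h1, h2, h3⟩
    obtain ⟨hf1, hc1⟩ := ih hes' hnd.2 K hK hd'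
    have hdisj : Disjoint {H : SimpleGraph V | K ≤ H ∧ H ≤ K ⊔ ofList es ∧ H.IsAcyclic}
        {H | K ⊔ edge u v ≤ H ∧ H ≤ K ⊔ edge u v ⊔ ofList es ∧ H.IsAcyclic} := by
      rw [Set.disjoint_left]
      rintro H ⟨-, h2, -⟩ ⟨h1, -, -⟩
      have huvH : H.Adj u v := h1 (Or.inr ((edge_adj ..).2 ⟨Or.inl ⟨rfl, rfl⟩, huv⟩))
      exact (h2 huvH).elim hKuv huves
    -- The forests containing `uv` are absent exactly when `uv` would close a cycle in `K`, which is
    -- the vanishing branch of `indepSum`.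
    by_cases hr : K.Reachable u v
    · have hempty : {H : SimpleGraph V | K ⊔ edge u v ≤ H ∧ H ≤ K ⊔ edge u v ⊔ ofList es ∧
          H.IsAcyclic} = ∅ := by
        rw [Set.eq_empty_iff_forall_notMem]
        rintro H ⟨h1, -, h3⟩
        rcases (isAcyclic_sup_fromEdgeSet_iff.1 (h3.anti h1)).2 hr with h | h
        exacts [huv h, hKuv h]
      rw [hsplit, hempty, Set.union_empty]
      refine ⟨hf1, ?_⟩
      rw [hc1, List.map_cons, indepSum, if_pos (edgeVec_mem_edgeSpan_iff.2 hr), add_zero]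
    · have hd'' : ∀ e ∈ es, ¬ (K ⊔ edge u v).Adj e.1 e.2 := by
        rintro ⟨a, b⟩ he (h | h)
        · exact hd' _ he h
        · rw [edge_adj] at h
          refine hnd.1 (List.mem_map.2 ⟨(a, b), he, ?_⟩)
          exact Sym2.eq_iff.2 (by tauto)
      obtain ⟨hf2, hc2⟩ := ih hes' hnd.2 (K ⊔ edge u v) (hK.sup_edge_of_not_reachable hr) hd''
      rw [hsplit]
      refine ⟨hf1.union hf2, ?_⟩
      rw [Set.ncard_union_eq hdisj hf1 hf2, hc1, hc2, List.map_cons, indepSum,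
        if_neg (mt edgeVec_mem_edgeSpan_iff.1 hr), edgeSpan_sup_edge K huv]

end SimpleGraph

theorem numSpanningForests_ofList {V : Type*} (es : List (V × V)) (hes : ∀ e ∈ es, e.1 ≠ e.2)
    (hnd : (es.map Sym2.mk.uncurry).Nodup) :
    numSpanningForests (SimpleGraph.ofList es) =
      indepSum (K := ZMod 2) (fun _ => 1) (es.map edgeVec) ⊥ := by
  have := (SimpleGraph.finite_and_ncard_acyclic_between es hes hnd ⊥ SimpleGraph.isAcyclic_bot
    (fun _ _ h => h)).2
  rw [SimpleGraph.edgeSpan_bot] at this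
  simp only [bot_le, true_and, bot_sup_eq] at this
  rw [← this]
  exact Nat.card_coe_set_eq _

theorem exists_map_subtype_val {V : Type*} {s : V → Prop} (es : List (V × V))
    (h : ∀ e ∈ es, s e.1 ∧ s e.2) :
    ∃ es' : List (Subtype s × Subtype s), es'.map (Prod.map Subtype.val Subtype.val) = es := by
  induction es with
  | nil => exact ⟨[], rfl⟩
  | cons e es ih =>
    obtain ⟨es', rfl⟩ := ih fun e he => h e (List.mem_cons_of_mem _ he)
    have he := h e List.mem_cons_self
    exact ⟨(⟨e.1, he.1⟩, ⟨e.2, he.2⟩) :: es', rfl⟩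

/-- The number of spanning forests of a graph whose adjacency is given by a list of edges in an
ambient type. -/
theorem numSpanningForests_eq_indepSum {V : Type*} {s : V → Prop} (G : SimpleGraph (Subtype s))
    (es : List (V × V)) (hs : ∀ e ∈ es, s e.1 ∧ s e.2) (hne : ∀ e ∈ es, e.1 ≠ e.2)
    (hnd : (es.map Sym2.mk.uncurry).Nodup)
    (hG : ∀ a b, G.Adj a b ↔ s(a.1, b.1) ∈ es.map Sym2.mk.uncurry) :
    numSpanningForests G = indepSum (K := ZMod 2) (fun _ => 1) (es.map edgeVec) ⊥ := by
  obtain ⟨es', rfl⟩ := exists_map_subtype_val es hs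
  have hmk : (es'.map (Prod.map Subtype.val Subtype.val)).map Sym2.mk.uncurry =
      (es'.map Sym2.mk.uncurry).map (Sym2.map Subtype.val) := by
    rw [List.map_map, List.map_map]
    rfl
  rw [hmk] at hnd
  have hne' : ∀ e ∈ es', e.1 ≠ e.2 := fun e he h =>
    hne _ (List.mem_map_of_mem he) (congrArg Subtype.val h)
  have hGe : G = SimpleGraph.ofList es' := by
    ext a b
    rw [hG, hmk, ← Sym2.map_mk, List.mem_map_of_injective (Sym2.map.injective Subtype.val_injective)]
    rw [SimpleGraph.ofList, SimpleGraph.fromEdgeSet_adj, Set.mem_ofPred_eq, iff_self_and]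
    intro h hab
    obtain ⟨e, he, heq⟩ := List.mem_map.1 h
    subst hab
    exact hne' e he (by
      rcases Sym2.eq_iff.1 heq with h | h <;> rw [h.1, h.2])
  rw [hGe, numSpanningForests_ofList es' hne' hnd.of_map]
  have hinj : Function.Injective
      (Finsupp.lmapDomain (ZMod 2) (ZMod 2) (Subtype.val : Subtype s → V)) :=
    Finsupp.mapDomain_injective Subtype.val_injective
  have := indepSum.map _ hinj (fun _ => 1) (es'.map edgeVec) ⊥
  rw [Submodule.map_bot] at this
  rw [← this, List.map_map, List.map_map]
  congr 2
  funext e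
  exact lmapDomain_edgeVec _ e

/-! ### Partitions of the vertices as labellings, and their subspaces. -/

section Labels

variable {V W Λ : Type*}

/-- The subspace of the combinations of vertices whose sum over each class of a labelling vanishes.
It is spanned by the vectors of the pairs of vertices with equal labels. -/
noncomputable def labelSpace (l : V → Λ) : Submodule (ZMod 2) (V →₀ ZMod 2) :=
  LinearMap.ker (Finsupp.lmapDomain (ZMod 2) (ZMod 2) l)

/-- The even combinations of vertices in a given set. -/
noncomputable def evenOn (A : Set V) : Submodule (ZMod 2) (V →₀ ZMod 2) :=
  Finsupp.supported (ZMod 2) (ZMod 2) A ⊓ labelSpace fun _ => ()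

theorem edgeVec_mem_labelSpace {l : V → Λ} {u v : V} :
    edgeVec (u, v) ∈ labelSpace l ↔ l u = l v := edgeVec_mem_ker_lmapDomain

theorem labelSpace_of_injective {l : V → Λ} (hl : Function.Injective l) : labelSpace l = ⊥ :=
  LinearMap.ker_eq_bot.2 (Finsupp.mapDomain_injective hl)

theorem labelSpace_le_comp (l : V → Λ) (f : Λ → W) : labelSpace l ≤ labelSpace (f ∘ l) := by
  intro x hx
  rw [labelSpace, LinearMap.mem_ker] at hx ⊢
  rw [Finsupp.lmapDomain_comp, LinearMap.comp_apply, hx, map_zero]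

theorem edgeVec_mem_evenOn {A : Set V} {u v : V} (hu : u ∈ A) (hv : v ∈ A) :
    edgeVec (u, v) ∈ evenOn A :=
  ⟨add_mem (Finsupp.single_mem_supported _ _ hu) (Finsupp.single_mem_supported _ _ hv),
    edgeVec_mem_labelSpace.2 rfl⟩

theorem evenOn_inter (A B : Set V) : evenOn (A ∩ B) = evenOn A ⊓ evenOn B := by
  rw [evenOn, evenOn, evenOn, Finsupp.supported_inter, ← inf_inf_distrib_right]

theorem evenOn_mono {A B : Set V} (h : A ⊆ B) : evenOn A ≤ evenOn B :=
  inf_le_inf_right _ (Finsupp.supported_mono h)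

theorem map_labelSpace_le_evenOn (l : V → Λ) (f : V → W) :
    (labelSpace l).map (Finsupp.lmapDomain (ZMod 2) (ZMod 2) f) ≤ evenOn (Set.range f) := by
  rw [Submodule.map_le_iff_le_comap]
  intro x hx
  refine ⟨?_, ?_⟩
  · rw [← Set.image_univ, ← Finsupp.lmapDomain_supported]
    exact Submodule.mem_map_of_mem (by simp)
  · have := labelSpace_le_comp l (fun _ => ()) hx
    refine LinearMap.mem_ker.2 ?_
    rw [← LinearMap.comp_apply, ← Finsupp.lmapDomain_comp]
    exact this

theorem evenOn_triple (a b c : V) :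
    evenOn {a, b, c} = Submodule.span (ZMod 2) {edgeVec (a, b), edgeVec (a, c)} := by
  apply le_antisymm
  · rintro x ⟨hx, hx0⟩
    rw [SetLike.mem_coe, Finsupp.supported_eq_span_single, Set.image_insert_eq, Set.image_pair,
      Submodule.mem_span_triple] at hx
    obtain ⟨α, β, γ, rfl⟩ := hx
    have h0 : α + β + γ = 0 := by
      have := DFunLike.congr_fun (LinearMap.mem_ker.1 hx0) ()
      simpa [Finsupp.mapDomain_add, Finsupp.mapDomain_smul, Finsupp.mapDomain_single] using this
    have hα : α = β + γ := by
      have := congrArg (· + (β + γ)) h0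
      simpa [add_assoc, zmod_two_add_self] using this
    rw [Submodule.mem_span_pair]
    refine ⟨β, γ, ?_⟩
    rw [hα, edgeVec, edgeVec]
    module
  · rw [Submodule.span_le, Set.pair_subset_iff]
    exact ⟨edgeVec_mem_evenOn (by simp) (by simp), edgeVec_mem_evenOn (by simp) (by simp)⟩

/-- Whether gluing in a triangle of the given partition index closes no cycle. -/
def JoinCompatible (a b c : V) (l : V → Λ) : Fin 5 → Prop :=
  ![True, l a ≠ l b, l a ≠ l c, l b ≠ l c, l a ≠ l b ∧ l a ≠ l c ∧ l b ≠ l c]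

theorem edgeVec_add_edgeVec' (a b c : V) : edgeVec (a, b) + edgeVec (a, c) = edgeVec (b, c) := by
  rw [edgeVec_comm, edgeVec_add_edgeVec]

/-- The nonzero vectors of each of the five subspaces are edge vectors of pairs of corners, so
disjointness says that none of these pairs has equal labels. -/
theorem disjoint_labelSpace_iff {a b c : V} (hab : a ≠ b) (hac : a ≠ c) (hbc : b ≠ c) (l : V → Λ)
    (i : Fin 5) :
    Disjoint (labelSpace l) (triangleSpan (edgeVec (a, b)) (edgeVec (a, c)) i) ↔
      JoinCompatible a b c l i := by
  have key {u v : V} (h : u ≠ v) :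
      Disjoint (labelSpace l) (ZMod 2 ∙ edgeVec (u, v)) ↔ l u ≠ l v := by
    rw [Submodule.disjoint_span_singleton' (mt edgeVec_eq_zero_iff.1 h), edgeVec_mem_labelSpace]
  match i with
  | 0 => exact iff_of_true disjoint_bot_right trivial
  | 1 => exact key hab
  | 2 => exact key hac
  | 3 =>
    refine Iff.trans ?_ (key hbc)
    rw [← edgeVec_add_edgeVec' a b c]
    rfl
  | 4 =>
    change Disjoint (labelSpace l) (Submodule.span (ZMod 2) {edgeVec (a, b), edgeVec (a, c)}) ↔
      l a ≠ l b ∧ l a ≠ l c ∧ l b ≠ l c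
    rw [Submodule.disjoint_def]
    simp only [mem_span_pair_zmod_two, edgeVec_add_edgeVec']
    constructor
    · intro h
      refine ⟨fun h' => hab ?_, fun h' => hac ?_, fun h' => hbc ?_⟩ <;>
      exact edgeVec_eq_zero_iff.1 (h _ (edgeVec_mem_labelSpace.2 h') (by simp))
    · rintro ⟨h1, h2, h3⟩ x hx (rfl | rfl | rfl | rfl)
      · rfl
      · exact absurd (edgeVec_mem_labelSpace.1 hx) h1
      · exact absurd (edgeVec_mem_labelSpace.1 hx) h2
      · exact absurd (edgeVec_mem_labelSpace.1 hx) h3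

variable [DecidableEq Λ]

/-- Identify the labels of `a` and `b`. -/
def mergeLabel (a b : V) (l : V → Λ) : V → Λ := fun v => if l v = l b then l a else l v

theorem labelSpace_mergeLabel (a b : V) (l : V → Λ) :
    labelSpace (mergeLabel a b l) = labelSpace l ⊔ ZMod 2 ∙ edgeVec (a, b) := by
  apply le_antisymm
  · intro x hx
    set m : Λ → Λ := fun k => if k = l b then l a else k with hm
    have hcomp : mergeLabel a b l = m ∘ l := rfl
    set y := Finsupp.lmapDomain (ZMod 2) (ZMod 2) l x with hy
    have hmy : Finsupp.lmapDomain (ZMod 2) (ZMod 2) m y = 0 := by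
      rw [hy, ← LinearMap.comp_apply, ← Finsupp.lmapDomain_comp]
      exact hx
    -- The correction clears the coefficient at `l b`, the only label moved by `m`. So `m` fixes
    -- `z`, while it also kills `z`; hence `z = 0`.
    set z := y + y (l b) • edgeVec (l a, l b) with hz
    by_cases hab : l a = l b
    · have : m = id := by
        funext k
        simp only [hm, id_eq]
        split_ifs with h
        · rw [h, hab]
        · rfl
      rw [this, Finsupp.lmapDomain_id, LinearMap.id_apply] at hmy
      exact Submodule.mem_sup_left hmy
    have hzb : z (l b) = 0 := by
      simp [hz, edgeVec, hab, zmod_two_add_self]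
    have hmz : Finsupp.lmapDomain (ZMod 2) (ZMod 2) m z = 0 := by
      rw [hz, map_add, hmy, map_smul, lmapDomain_edgeVec]
      simp [hm, edgeVec_self]
    have hmz' : Finsupp.lmapDomain (ZMod 2) (ZMod 2) m z = z := by
      rw [Finsupp.lmapDomain_apply]
      conv_rhs => rw [← Finsupp.mapDomain_id (v := z)]
      refine Finsupp.mapDomain_congr fun k hk => ?_
      have : k ≠ l b := by
        rintro rfl
        exact (Finsupp.mem_support_iff.1 hk) hzb
      simp [hm, this]
    rw [hmz] at hmz'
    have : x + y (l b) • edgeVec (a, b) ∈ labelSpace l := by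
      rw [labelSpace, LinearMap.mem_ker, map_add, map_smul, lmapDomain_edgeVec]
      rw [← hy, Prod.map_apply, ← hz, ← hmz']
    have h2 := Submodule.add_mem_sup this
      (Submodule.smul_mem _ (y (l b)) (Submodule.mem_span_singleton_self (R := ZMod 2)
        (edgeVec (a, b))))
    rwa [add_assoc, zmod_two_add_self, add_zero] at h2
  · refine sup_le (labelSpace_le_comp l fun k => if k = l b then l a else k) ?_
    rw [Submodule.span_singleton_le_iff_mem, edgeVec_mem_labelSpace]
    simp [mergeLabel]

/-- The labelling after gluing in a triangle of the given partition index. -/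
def joinLabel (a b c : V) (l : V → Λ) : Fin 5 → V → Λ :=
  ![l, mergeLabel a b l, mergeLabel a c l, mergeLabel b c l, mergeLabel a c (mergeLabel a b l)]

instance (a b c : V) (l : V → Λ) (i : Fin 5) : Decidable (JoinCompatible a b c l i) := by
  match i with
  | 0 => exact instDecidableTrue
  | 1 => exact inferInstanceAs (Decidable (l a ≠ l b))
  | 2 => exact inferInstanceAs (Decidable (l a ≠ l c))
  | 3 => exact inferInstanceAs (Decidable (l b ≠ l c))
  | 4 => exact inferInstanceAs (Decidable (l a ≠ l b ∧ l a ≠ l c ∧ l b ≠ l c))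

/-- The partition index of the labels of three vertices. -/
def labelIndex (a b c : V) (l : V → Λ) : Fin 5 :=
  if l a = l b then if l a = l c then 4 else 1 else if l a = l c then 2 else
    if l b = l c then 3 else 0

theorem triangleIndex_labelSpace (a b c : V) (l : V → Λ) :
    triangleIndex (edgeVec (a, b)) (edgeVec (a, c)) (labelSpace l) = labelIndex a b c l := by
  classical
  simp only [triangleIndex, edgeVec_add_edgeVec', labelIndex]
  exact if_congr edgeVec_mem_labelSpace (if_congr edgeVec_mem_labelSpace rfl rfl)
    (if_congr edgeVec_mem_labelSpace rfl (if_congr edgeVec_mem_labelSpace rfl rfl))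

theorem labelSpace_joinLabel (a b c : V) (l : V → Λ) (i : Fin 5) :
    labelSpace (joinLabel a b c l i) =
      labelSpace l ⊔ triangleSpan (edgeVec (a, b)) (edgeVec (a, c)) i := by
  match i with
  | 0 => exact (sup_bot_eq _).symm
  | 1 => exact labelSpace_mergeLabel ..
  | 2 => exact labelSpace_mergeLabel ..
  | 3 =>
    refine (labelSpace_mergeLabel ..).trans ?_
    rw [← edgeVec_add_edgeVec' a]
    rfl
  | 4 =>
    refine (labelSpace_mergeLabel ..).trans ?_
    rw [labelSpace_mergeLabel, sup_assoc, ← Submodule.span_union]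
    rfl

/-- The weighted sum over the ways to glue in triangles one after the other without closing a cycle,
where `w` gives the weights of the five partitions of the vertices of a triangle. -/
def glueSum (w : Fin 5 → ℕ) (φ : (V → Λ) → ℕ) : List (V × V × V) → (V → Λ) → ℕ
  | [], l => φ l
  | (a, b, c) :: ts, l => ∑ i, w i *
      if JoinCompatible a b c l i then glueSum w φ ts (joinLabel a b c l i) else 0

end Labels

/-! ### Cells of the gasket and the recursion for the partition counts. -/

theorem triangleSpan_map {M N : Type*} [AddCommGroup M] [Module (ZMod 2) M] [AddCommGroup N]
    [Module (ZMod 2) N] (f : M →ₗ[ZMod 2] N) (x y : M) (i : Fin 5) :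
    triangleSpan (f x) (f y) i = (triangleSpan x y i).map f := by
  match i with
  | 0 => exact (Submodule.map_bot f).symm
  | 1 | 2 =>
    simp only [triangleSpan, Matrix.cons_val]
    rw [Submodule.map_span, Set.image_singleton]
  | 3 =>
    simp only [triangleSpan, Matrix.cons_val]
    rw [Submodule.map_span, Set.image_singleton, map_add]
  | 4 =>
    simp only [triangleSpan, Matrix.cons_val]
    rw [Submodule.map_span, Set.image_pair]

namespace SierpinskiGasket

/-- The points of the upward triangle of side length `L` with lower left corner `L • c`. -/
def cellRegion (L : ℕ) (c : ℕ × ℕ) : Set (ℕ × ℕ) :=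
  {p | L * c.1 ≤ p.1 ∧ L * c.2 ≤ p.2 ∧ p.1 + p.2 ≤ L * (c.1 + c.2 + 1)}

/-- The points that are not in a given triangle, except for corners of such triangles. -/
def cellOutside (L : ℕ) (c : ℕ × ℕ) : Set (ℕ × ℕ) :=
  {p | p ∈ cellRegion L c → p ∈ Set.range fun q : ℕ × ℕ => L • q}

/-- The corners of the unit triangle with lower left corner `c`. -/
def cellCorners (c : ℕ × ℕ) : (ℕ × ℕ) × (ℕ × ℕ) × (ℕ × ℕ) := (c, c + (1, 0), c + (0, 1))

theorem add_mem_cellRegion {L : ℕ} (c : ℕ × ℕ) {p : ℕ × ℕ} (hp : p ∈ cellRegion L 0) :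
    L • c + p ∈ cellRegion L c := by
  obtain ⟨c1, c2⟩ := c
  obtain ⟨p1, p2⟩ := p
  obtain ⟨-, -, h⟩ := hp
  simp only [Prod.fst_zero, Prod.snd_zero, add_zero, zero_add, mul_one] at h
  refine ⟨?_, ?_, ?_⟩ <;> simp [mul_add]
  omega

theorem smul_mem_cellRegion_iff {L : ℕ} (hL : 0 < L) (c q : ℕ × ℕ) :
    L • q ∈ cellRegion L c ↔ q = c ∨ q = c + (1, 0) ∨ q = c + (0, 1) := by
  obtain ⟨c1, c2⟩ := c
  obtain ⟨q1, q2⟩ := q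
  have : (L • (q1, q2) ∈ cellRegion L (c1, c2)) ↔ c1 ≤ q1 ∧ c2 ≤ q2 ∧ q1 + q2 ≤ c1 + c2 + 1 := by
    change (L * c1 ≤ L * q1 ∧ L * c2 ≤ L * q2 ∧ L * q1 + L * q2 ≤ L * (c1 + c2 + 1)) ↔ _
    rw [← mul_add, Nat.mul_le_mul_left_iff hL, Nat.mul_le_mul_left_iff hL,
      Nat.mul_le_mul_left_iff hL]
  rw [this]
  simp only [Prod.mk_add_mk, Prod.mk.injEq]
  omega

theorem cellOutside_inter_cellRegion {L : ℕ} (hL : 0 < L) (c : ℕ × ℕ) :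
    cellOutside L c ∩ cellRegion L c = {L • c, L • (c + (1, 0)), L • (c + (0, 1))} := by
  ext p
  constructor
  · rintro ⟨h1, h2⟩
    obtain ⟨q, rfl⟩ := h1 h2
    rcases (smul_mem_cellRegion_iff hL c q).1 h2 with rfl | rfl | rfl <;> simp
  · intro h
    obtain ⟨q, hq, rfl⟩ : ∃ q, (q = c ∨ q = c + (1, 0) ∨ q = c + (0, 1)) ∧ p = L • q := by
      rcases h with h | h | h
      exacts [⟨_, Or.inl rfl, h⟩, ⟨_, Or.inr (Or.inl rfl), h⟩, ⟨_, Or.inr (Or.inr rfl), h⟩]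
    exact ⟨fun _ => ⟨q, rfl⟩, (smul_mem_cellRegion_iff hL c q).2 hq⟩

/-- An upward triangle of side `L` reaches `L` beyond its lower left corner, in either coordinate,
only at another corner. Every other point recovers its triangle by rounding down, so distinct
triangles meet only in corners. -/
theorem eq_div_of_mem_cellRegion {L : ℕ} {c p : ℕ × ℕ} (h : p ∈ cellRegion L c)
    (hp : p ∉ Set.range fun q : ℕ × ℕ => L • q) : c = (p.1 / L, p.2 / L) := by
  obtain ⟨c1, c2⟩ := c
  obtain ⟨p1, p2⟩ := p
  obtain ⟨h1, h2, h3⟩ := h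
  simp only [mul_add, mul_one] at h1 h2 h3
  have h4 : p1 < L * c1 + L := by
    by_contra! h
    refine hp ⟨(c1 + 1, c2), ?_⟩
    simp only [Prod.smul_mk, smul_eq_mul, mul_add, mul_one, Prod.mk.injEq]
    omega
  have h5 : p2 < L * c2 + L := by
    by_contra! h
    refine hp ⟨(c1, c2 + 1), ?_⟩
    simp only [Prod.smul_mk, smul_eq_mul, mul_add, mul_one, Prod.mk.injEq]
    omega
  rw [Prod.mk.injEq]
  constructor
  · exact (Nat.div_eq_of_lt_le (by rw [mul_comm]; exact h1) (by rw [add_mul, mul_comm]; omega)).symm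
  · exact (Nat.div_eq_of_lt_le (by rw [mul_comm]; exact h2) (by rw [add_mul, mul_comm]; omega)).symm

theorem cellRegion_subset_cellOutside {L : ℕ} {c c' : ℕ × ℕ} (h : c ≠ c') :
    cellRegion L c' ⊆ cellOutside L c := by
  intro p hp' hp
  by_contra hl
  exact h ((eq_div_of_mem_cellRegion hp hl).trans (eq_div_of_mem_cellRegion hp' hl).symm)

theorem range_subset_cellOutside (L : ℕ) (c : ℕ × ℕ) :
    Set.range (fun q : ℕ × ℕ => L • q) ⊆ cellOutside L c := fun _ hp _ => hp

/-- The edges of the copies of a finite graph in the triangles `cs`. -/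
def glueEdges (L : ℕ) (E : List ((ℕ × ℕ) × (ℕ × ℕ))) (cs : List (ℕ × ℕ)) :
    List ((ℕ × ℕ) × (ℕ × ℕ)) :=
  cs.flatMap fun c => E.map (Prod.map (L • c + ·) (L • c + ·))

theorem mem_glueEdges {L : ℕ} {E : List ((ℕ × ℕ) × (ℕ × ℕ))} {cs : List (ℕ × ℕ)}
    {e : (ℕ × ℕ) × (ℕ × ℕ)} :
    e ∈ glueEdges L E cs ↔ ∃ c ∈ cs, ∃ e' ∈ E, (L • c + e'.1, L • c + e'.2) = e := by
  simp only [glueEdges, List.mem_flatMap, List.mem_map]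
  rfl

/-- The partition counts, with respect to the corners of a triangle of side length `L`, of the
forests with edges from `E`. -/
noncomputable def cornerCount (L : ℕ) (E : List ((ℕ × ℕ) × (ℕ × ℕ))) : Fin 5 → ℕ :=
  triangleCount (edgeVec ((0 : ℕ × ℕ), (L, 0))) (edgeVec ((0 : ℕ × ℕ), (0, L))) (E.map edgeVec)

/-- The multiplication of points by a scalar, as a linear map. -/
noncomputable def scaleMap (L : ℕ) : (ℕ × ℕ →₀ ZMod 2) →ₗ[ZMod 2] (ℕ × ℕ →₀ ZMod 2) :=
  Finsupp.lmapDomain (ZMod 2) (ZMod 2) (fun q => L • q)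

theorem smul_injective {L : ℕ} (hL : 0 < L) : Function.Injective fun q : ℕ × ℕ => L • q := by
  rintro ⟨a, b⟩ ⟨c, d⟩ h
  simp only [Prod.smul_mk, smul_eq_mul, Prod.mk.injEq, mul_eq_mul_left_iff] at h ⊢
  omega

theorem scaleMap_injective {L : ℕ} (hL : 0 < L) : Function.Injective (scaleMap L) :=
  Finsupp.mapDomain_injective (smul_injective hL)

theorem cornerCount_translate (L : ℕ) (E : List ((ℕ × ℕ) × (ℕ × ℕ))) (c : ℕ × ℕ) :
    triangleCount (scaleMap L (edgeVec (c, c + (1, 0)))) (scaleMap L (edgeVec (c, c + (0, 1))))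
      ((E.map (Prod.map (L • c + ·) (L • c + ·))).map edgeVec) = cornerCount L E := by
  funext i
  have hinj : Function.Injective
      (Finsupp.lmapDomain (ZMod 2) (ZMod 2) (fun p : ℕ × ℕ => L • c + p)) :=
    Finsupp.mapDomain_injective (add_right_injective _)
  rw [cornerCount, ← triangleCount_map _ hinj (edgeVec (0, (L, 0))), lmapDomain_edgeVec, lmapDomain_edgeVec,
    List.map_map, List.map_map, scaleMap, lmapDomain_edgeVec, lmapDomain_edgeVec]
  congr 1
  · refine List.map_congr_left fun e _ => ?_
    exact (lmapDomain_edgeVec _ e).symm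

/-- One copy is split off at a time: its vectors lie in `evenOn (cellRegion L c)`, everything else
in `evenOn (cellOutside L c)`, and these meet in the plane of the three corners. The current
subspace is always the scaled image of the subspace of a labelling of the coarse points, so the fine
structure enters only through `cornerCount`. -/
theorem indepSum_glueEdges {Λ : Type*} [DecidableEq Λ] {L : ℕ} (hL : 0 < L)
    {E : List ((ℕ × ℕ) × (ℕ × ℕ))}
    (hE : ∀ e ∈ E, e.1 ∈ cellRegion L 0 ∧ e.2 ∈ cellRegion L 0)
    {φ : Submodule (ZMod 2) (ℕ × ℕ →₀ ZMod 2) → ℕ}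
    {cs : List (ℕ × ℕ)} (hcs : cs.Nodup)
    (hφ : ∀ c ∈ cs, ∀ U, φ U = φ (U ⊓ evenOn (cellOutside L c))) (l : ℕ × ℕ → Λ) :
    indepSum φ ((glueEdges L E cs).map edgeVec) ((labelSpace l).map (scaleMap L)) =
      glueSum (cornerCount L E) (fun l => φ ((labelSpace l).map (scaleMap L)))
        (cs.map cellCorners) l := by
  induction cs generalizing l with
  | nil => rfl
  | cons c cs ih =>
    rw [List.nodup_cons] at hcs
    have ih := ih hcs.2 fun c' hc' => hφ c' (List.mem_cons_of_mem _ hc')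
    have hloc : ∀ U, indepSum φ ((glueEdges L E cs).map edgeVec) U =
        indepSum φ ((glueEdges L E cs).map edgeVec) (U ⊓ evenOn (cellOutside L c)) := by
      refine indepSum.inf_right (hφ c List.mem_cons_self) ?_
      intro x hx
      obtain ⟨e, he, rfl⟩ := List.mem_map.1 hx
      obtain ⟨c', hc', e', he', rfl⟩ := mem_glueEdges.1 he
      have hne : c ≠ c' := by
        rintro rfl
        exact hcs.1 hc'
      exact edgeVec_mem_evenOn
        (cellRegion_subset_cellOutside hne (add_mem_cellRegion c' (hE e' he').1))
        (cellRegion_subset_cellOutside hne (add_mem_cellRegion c' (hE e' he').2))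
    have hXY : evenOn (cellOutside L c) ⊓ evenOn (cellRegion L c) = Submodule.span (ZMod 2)
        {scaleMap L (edgeVec (c, c + (1, 0))), scaleMap L (edgeVec (c, c + (0, 1)))} := by
      rw [← evenOn_inter, cellOutside_inter_cellRegion hL, evenOn_triple, scaleMap,
        lmapDomain_edgeVec, lmapDomain_edgeVec]
      rfl
    have hU : (labelSpace l).map (scaleMap L) ≤ evenOn (cellOutside L c) :=
      (map_labelSpace_le_evenOn l _).trans (evenOn_mono (range_subset_cellOutside L c))
    have hes : ∀ x ∈ (E.map (Prod.map (L • c + ·) (L • c + ·))).map edgeVec,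
        x ∈ evenOn (cellRegion L c) := by
      intro x hx
      obtain ⟨e, he, rfl⟩ := List.mem_map.1 hx
      obtain ⟨e', he', rfl⟩ := List.mem_map.1 he
      exact edgeVec_mem_evenOn (add_mem_cellRegion c (hE e' he').1)
        (add_mem_cellRegion c (hE e' he').2)
    have hcons : glueEdges L E (c :: cs) =
        E.map (Prod.map (L • c + ·) (L • c + ·)) ++ glueEdges L E cs := rfl
    rw [hcons, List.map_append, indepSum.append,
      indepSum_eq_sum_triangleCount hloc hXY hU hes, cornerCount_translate, List.map_cons,
      cellCorners, glueSum]
    refine Finset.sum_congr rfl fun i _ => ?_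
    rw [triangleSpan_map]
    have hd : Disjoint ((labelSpace l).map (scaleMap L))
        ((triangleSpan (edgeVec (c, c + (1, 0))) (edgeVec (c, c + (0, 1))) i).map (scaleMap L)) ↔
        JoinCompatible c (c + (1, 0)) (c + (0, 1)) l i := by
      rw [← disjoint_labelSpace_iff (by simp [Prod.ext_iff]) (by simp [Prod.ext_iff])
        (by simp [Prod.ext_iff])]
      refine ⟨fun h => ?_, Submodule.disjoint_map (scaleMap_injective hL)⟩
      rw [Submodule.disjoint_def] at h ⊢
      intro x hx hx'
      refine scaleMap_injective hL ((h _ ⟨x, hx, rfl⟩ ⟨x, hx', rfl⟩).trans ?_)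
      exact (map_zero _).symm
    rw [← Submodule.map_sup, ← labelSpace_joinLabel, ih]
    congr 1
    split_ifs <;> tauto

theorem scaleMap_edgeVec_mem_evenOn {L : ℕ} (c : ℕ × ℕ) (u v : ℕ × ℕ) :
    scaleMap L (edgeVec (u, v)) ∈ evenOn (cellOutside L c) := by
  rw [scaleMap, lmapDomain_edgeVec]
  exact edgeVec_mem_evenOn (range_subset_cellOutside L c ⟨u, rfl⟩)
    (range_subset_cellOutside L c ⟨v, rfl⟩)

/-- The recursion for the partition counts. -/
theorem cornerCount_glueEdges {L b : ℕ} (hL : 0 < L) {E : List ((ℕ × ℕ) × (ℕ × ℕ))}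
    (hE : ∀ e ∈ E, e.1 ∈ cellRegion L 0 ∧ e.2 ∈ cellRegion L 0)
    {cs : List (ℕ × ℕ)} (hcs : cs.Nodup) {Λ : Type*} [DecidableEq Λ] {l : ℕ × ℕ → Λ}
    (hl : Function.Injective l) (i : Fin 5) :
    cornerCount (b * L) (glueEdges L E cs) i = glueSum (cornerCount L E)
      (fun l => if labelIndex (0, 0) (b, 0) (0, b) l = i then 1 else 0) (cs.map cellCorners) l := by
  classical
  have hx (u : ℕ × ℕ) : edgeVec ((0 : ℕ × ℕ), L • u) = scaleMap L (edgeVec (0, u)) := by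
    rw [scaleMap, lmapDomain_edgeVec]
    simp
  have h1 : ((b * L, 0) : ℕ × ℕ) = L • (b, 0) := by simp [mul_comm]
  have h2 : ((0, b * L) : ℕ × ℕ) = L • (0, b) := by simp [mul_comm]
  -- The corners of the large triangle are themselves multiples of `L`, so reading off their
  -- partition sees only the part outside any given cell.
  have := indepSum_glueEdges hL hE hcs (φ := fun W => if triangleIndex
      (scaleMap L (edgeVec (0, (b, 0)))) (scaleMap L (edgeVec (0, (0, b)))) W = i then 1 else 0)
    (fun c _ U => by
      rw [triangleIndex_inf (scaleMap_edgeVec_mem_evenOn c _ _) (scaleMap_edgeVec_mem_evenOn c _ _)]) l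
  rw [labelSpace_of_injective hl, Submodule.map_bot] at this
  rw [cornerCount, triangleCount, h1, h2, hx, hx]
  refine (Eq.trans ?_ this).trans ?_
  · congr!
  · congr! 4
    rw [triangleIndex_map _ (scaleMap_injective hL), triangleIndex_labelSpace]
    rfl

end SierpinskiGasket

/-! ### Counting vertices. -/

namespace SierpinskiGasket

section Geometry

variable {b : ℕ}

theorem mem_cellRegion_zero {L : ℕ} {p : ℕ × ℕ} : p ∈ cellRegion L 0 ↔ p.1 + p.2 ≤ L := by
  simp [cellRegion]

theorem vertices_subset_cellRegion {n : ℕ} {p : ℕ × ℕ} (hp : p ∈ vertices b n) :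
    p ∈ cellRegion (b ^ n) 0 := by
  induction n generalizing p with
  | zero =>
    simp only [vertices, unitTriangle, Finset.mem_insert, Finset.mem_singleton] at hp
    rcases hp with rfl | rfl | rfl <;> simp [mem_cellRegion_zero]
  | succ n ih =>
    simp only [vertices, Finset.mem_biUnion, Finset.mem_image, cells, Finset.mem_filter] at hp
    obtain ⟨c, ⟨-, hc⟩, p, hp, rfl⟩ := hp
    have := mem_cellRegion_zero.1 (ih hp)
    rw [mem_cellRegion_zero]
    calc _ = b ^ n * (c.1 + c.2) + (p.1 + p.2) := by simp; ring
      _ ≤ b ^ n * (c.1 + c.2) + b ^ n * 1 := by omega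
      _ = b ^ n * (c.1 + c.2 + 1) := by ring
      _ ≤ b ^ (n + 1) := by rw [pow_succ]; exact Nat.mul_le_mul_left _ hc

theorem smul_unitTriangle_mem_vertices (hb : 0 < b) (n : ℕ) {t : ℕ × ℕ} (ht : t ∈ unitTriangle) :
    b ^ n • t ∈ vertices b n := by
  induction n with
  | zero => simpa [vertices] using ht
  | succ n ih =>
    simp only [vertices, Finset.mem_biUnion, Finset.mem_image]
    refine ⟨(b - 1) • t, ?_, _, ih, ?_⟩
    · simp only [unitTriangle, Finset.mem_insert, Finset.mem_singleton] at ht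
      simp only [cells, Finset.mem_filter, Finset.mem_product, Finset.mem_range]
      rcases ht with rfl | rfl | rfl <;> simp <;> omega
    · rw [smul_smul, ← add_smul, pow_succ]
      congr 1
      obtain ⟨k, rfl⟩ : ∃ k, b = k + 1 := ⟨b - 1, by omega⟩
      simp only [Nat.add_sub_cancel]
      ring

/-- The vertices of the gasket that are not corners. -/
def innerVertices (b n : ℕ) : Finset (ℕ × ℕ) :=
  vertices b n \ unitTriangle.image fun t => b ^ n • t

theorem innerVertices_subset (b n : ℕ) : innerVertices b n ⊆ vertices b n := Finset.sdiff_subset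

theorem not_mem_range_of_mem_innerVertices (hb : 0 < b) {n : ℕ} {p : ℕ × ℕ}
    (hp : p ∈ innerVertices b n) (c : ℕ × ℕ) :
    b ^ n • c + p ∉ Set.range fun q : ℕ × ℕ => b ^ n • q := by
  rintro ⟨q, hq⟩
  obtain ⟨hp, hpc⟩ := Finset.mem_sdiff.1 hp
  refine hpc (Finset.mem_image.2 ?_)
  have h := add_mem_cellRegion c (vertices_subset_cellRegion hp)
  rw [← hq, smul_mem_cellRegion_iff (Nat.pow_pos hb)] at h
  rcases h with rfl | rfl | rfl
  · refine ⟨(0, 0), by simp [unitTriangle], ?_⟩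
    have h0 : p = 0 := left_eq_add.1 (show b ^ n • q = b ^ n • q + p from hq)
    rw [h0]
    exact smul_zero _
  · refine ⟨(1, 0), by simp [unitTriangle], ?_⟩
    exact add_left_cancel ((smul_add _ _ _).symm.trans hq)
  · refine ⟨(0, 1), by simp [unitTriangle], ?_⟩
    exact add_left_cancel ((smul_add _ _ _).symm.trans hq)

/-- A vertex that is not a corner of its copy belongs to one copy only; the corners of all copies
together form the scaled first stage. -/
theorem vertices_succ_eq (hb : 0 < b) (n : ℕ) :
    vertices b (n + 1) = ((cells b).biUnion fun c => (innerVertices b n).image (b ^ n • c + ·)) ∪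
      (vertices b 1).image fun t => b ^ n • t := by
  ext p
  simp only [vertices, Finset.mem_union, Finset.mem_biUnion, Finset.mem_image, pow_zero, one_smul]
  constructor
  · rintro ⟨c, hc, p, hp, rfl⟩
    by_cases h : p ∈ unitTriangle.image fun t => b ^ n • t
    · obtain ⟨t, ht, rfl⟩ := Finset.mem_image.1 h
      exact Or.inr ⟨c + t, ⟨c, hc, t, ht, rfl⟩, smul_add _ _ _⟩
    · exact Or.inl ⟨c, hc, p, Finset.mem_sdiff.2 ⟨hp, h⟩, rfl⟩
  · rintro (⟨c, hc, p, hp, rfl⟩ | ⟨_, ⟨c, hc, t, ht, rfl⟩, rfl⟩)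
    · exact ⟨c, hc, p, (Finset.mem_sdiff.1 hp).1, rfl⟩
    · exact ⟨c, hc, _, smul_unitTriangle_mem_vertices hb n ht, (smul_add _ _ _).symm⟩

theorem card_innerVertices (hb : 0 < b) (n : ℕ) :
    (innerVertices b n).card + 3 = (vertices b n).card := by
  have hsub : (unitTriangle.image fun t => b ^ n • t) ⊆ vertices b n := by
    intro p hp
    obtain ⟨t, ht, rfl⟩ := Finset.mem_image.1 hp
    exact smul_unitTriangle_mem_vertices hb n ht
  rw [innerVertices, ← Finset.card_sdiff_add_card_eq_card hsub,
    Finset.card_image_of_injective _ (smul_injective (Nat.pow_pos hb))]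
  rfl

theorem card_vertices_succ (hb : 0 < b) (n : ℕ) :
    (vertices b (n + 1)).card =
      (cells b).card * (innerVertices b n).card + (vertices b 1).card := by
  rw [vertices_succ_eq hb, Finset.card_union_of_disjoint,
    Finset.card_image_of_injective _ (smul_injective (Nat.pow_pos hb)), Finset.card_biUnion]
  · congr 1
    rw [Finset.sum_congr rfl fun c _ =>
      Finset.card_image_of_injective (innerVertices b n) (add_right_injective (b ^ n • c)),
      Finset.sum_const, smul_eq_mul]
  · intro c _ c' _ hne
    rw [Function.onFun, Finset.disjoint_left]
    rintro _ hq hq'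
    obtain ⟨p, hp, rfl⟩ := Finset.mem_image.1 hq
    obtain ⟨p', hp', heq⟩ := Finset.mem_image.1 hq'
    have hnm := not_mem_range_of_mem_innerVertices hb hp c
    have h1 := add_mem_cellRegion c (vertices_subset_cellRegion (innerVertices_subset b n hp))
    have h2 := add_mem_cellRegion c' (vertices_subset_cellRegion (innerVertices_subset b n hp'))
    rw [heq] at h2
    exact hne ((eq_div_of_mem_cellRegion h1 hnm).trans (eq_div_of_mem_cellRegion h2 hnm).symm)
  · rw [Finset.disjoint_left]
    intro q hq hq'
    obtain ⟨c, -, hq⟩ := Finset.mem_biUnion.1 hq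
    obtain ⟨p, hp, rfl⟩ := Finset.mem_image.1 hq
    obtain ⟨t, -, ht⟩ := Finset.mem_image.1 hq'
    exact not_mem_range_of_mem_innerVertices hb hp c ⟨t, ht⟩

theorem three_mul_card_vertices_four (n : ℕ) : 3 * (vertices 4 n).card = 4 * 10 ^ n + 5 := by
  induction n with
  | zero => rfl
  | succ n ih =>
    have h1 := card_vertices_succ (b := 4) (by norm_num) n
    have h2 := card_innerVertices (b := 4) (by norm_num) n
    have h3 : (cells 4).card = 10 := by decide
    have h4 : (vertices 4 1).card = 15 := by decide
    rw [h3, h4] at h1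
    -- The recurrence is `v (n + 1) = 10 * (v n - 3) + 15`, where `15` is the size of the first
    -- stage.
    rw [pow_succ]
    omega

end Geometry

/-! ### The gasket as a duplicate-free list of edges. -/

section Edges

variable {b : ℕ} {cs : List (ℕ × ℕ)}

/-- The list of edges of the gasket, built from copies in the triangles `cs`. -/
def edgeList (b : ℕ) (cs : List (ℕ × ℕ)) : ℕ → List ((ℕ × ℕ) × (ℕ × ℕ))
  | 0 => [((0, 0), (1, 0)), ((0, 0), (0, 1)), ((1, 0), (0, 1))]
  | n + 1 => glueEdges (b ^ n) (edgeList b cs n) cs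

theorem mem_vertices_of_mem_edgeList (hcs : ∀ c ∈ cs, c ∈ cells b) {n : ℕ}
    {e : (ℕ × ℕ) × (ℕ × ℕ)} (he : e ∈ edgeList b cs n) :
    e.1 ∈ vertices b n ∧ e.2 ∈ vertices b n := by
  induction n generalizing e with
  | zero =>
    simp only [edgeList, List.mem_cons, List.not_mem_nil, or_false] at he
    rcases he with rfl | rfl | rfl <;> simp [vertices, unitTriangle]
  | succ n ih =>
    obtain ⟨c, hc, e, he', rfl⟩ := mem_glueEdges.1 he
    simp only [vertices, Finset.mem_biUnion, Finset.mem_image]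
    exact ⟨⟨c, hcs c hc, _, (ih he').1, rfl⟩, ⟨c, hcs c hc, _, (ih he').2, rfl⟩⟩

theorem edgeList_subset_cellRegion (hcs : ∀ c ∈ cs, c ∈ cells b) (n : ℕ) :
    ∀ e ∈ edgeList b cs n, e.1 ∈ cellRegion (b ^ n) 0 ∧ e.2 ∈ cellRegion (b ^ n) 0 :=
  fun _ he => ⟨vertices_subset_cellRegion (mem_vertices_of_mem_edgeList hcs he).1,
    vertices_subset_cellRegion (mem_vertices_of_mem_edgeList hcs he).2⟩

theorem edge_iff_mem_edgeList (hcs : ∀ c, c ∈ cs ↔ c ∈ cells b) {n : ℕ} {p q : ℕ × ℕ} :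
    Edge b n p q ↔ s(p, q) ∈ (edgeList b cs n).map Sym2.mk.uncurry := by
  induction n generalizing p q with
  | zero =>
    simp only [Edge, unitTriangle, Finset.mem_insert, Finset.mem_singleton, edgeList, List.map_cons,
      List.map_nil, List.mem_cons, List.not_mem_nil, or_false, Function.uncurry_apply_pair,
      Sym2.eq_iff]
    constructor
    · rintro ⟨rfl | rfl | rfl, rfl | rfl | rfl, h⟩ <;> simp at h ⊢
    · rintro ((⟨rfl, rfl⟩ | ⟨rfl, rfl⟩) | (⟨rfl, rfl⟩ | ⟨rfl, rfl⟩) | (⟨rfl, rfl⟩ | ⟨rfl, rfl⟩)) <;>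
        simp
  | succ n ih =>
    simp only [Edge, List.mem_map, edgeList]
    constructor
    · rintro ⟨c, hc, p', q', h, rfl, rfl⟩
      obtain ⟨e, he, heq⟩ := List.mem_map.1 (ih.1 h)
      refine ⟨_, mem_glueEdges.2 ⟨c, (hcs c).2 hc, e, he, rfl⟩, ?_⟩
      have := congrArg (Sym2.map (b ^ n • c + ·)) heq
      exact this
    · rintro ⟨e, he, heq⟩
      obtain ⟨c, hc, e, he', rfl⟩ := mem_glueEdges.1 he
      have hE : Edge b n e.1 e.2 := ih.2 (List.mem_map.2 ⟨e, he', rfl⟩)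
      rcases Sym2.eq_iff.1 heq with ⟨rfl, rfl⟩ | ⟨rfl, rfl⟩
      · exact ⟨c, (hcs c).1 hc, e.1, e.2, hE, rfl, rfl⟩
      · exact ⟨c, (hcs c).1 hc, e.2, e.1, hE.symm, rfl, rfl⟩

theorem ne_of_mem_edgeList (hcs : ∀ c, c ∈ cs ↔ c ∈ cells b) {n : ℕ} {e : (ℕ × ℕ) × (ℕ × ℕ)}
    (he : e ∈ edgeList b cs n) : e.1 ≠ e.2 :=
  ((edge_iff_mem_edgeList hcs).2 (List.mem_map.2 ⟨e, he, rfl⟩)).ne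

/-- Distinct upward triangles share at most one corner. Hence no edge occurs in two copies. -/
theorem eq_of_mem_cellRegion {L : ℕ} (hL : 0 < L) {c c' p q : ℕ × ℕ} (hpq : p ≠ q)
    (hp : p ∈ cellRegion L c) (hp' : p ∈ cellRegion L c') (hq : q ∈ cellRegion L c)
    (hq' : q ∈ cellRegion L c') : c = c' := by
  by_contra hne
  obtain ⟨u, rfl⟩ := cellRegion_subset_cellOutside hne hp' hp
  obtain ⟨v, rfl⟩ := cellRegion_subset_cellOutside hne hq' hq
  have huv : u ≠ v := fun h => hpq (by rw [h])
  beta_reduce at hp hp' hq hq'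
  rw [smul_mem_cellRegion_iff hL] at hp hp' hq hq'
  obtain ⟨c1, c2⟩ := c
  obtain ⟨d1, d2⟩ := c'
  obtain ⟨u1, u2⟩ := u
  obtain ⟨v1, v2⟩ := v
  simp only [Prod.mk_add_mk, Prod.mk.injEq, ne_eq] at *
  omega

theorem nodup_edgeList (hb : 0 < b) (hnd : cs.Nodup) (hcs : ∀ c, c ∈ cs ↔ c ∈ cells b) (n : ℕ) :
    ((edgeList b cs n).map Sym2.mk.uncurry).Nodup := by
  induction n with
  | zero => simp [edgeList]
  | succ n ih =>
    have hreg := edgeList_subset_cellRegion (fun c hc => (hcs c).1 hc) n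
    rw [edgeList, glueEdges, List.map_flatMap, List.nodup_flatMap]
    constructor
    · intro c _
      have : ((edgeList b cs n).map (Prod.map (b ^ n • c + ·) (b ^ n • c + ·))).map
          Sym2.mk.uncurry = ((edgeList b cs n).map Sym2.mk.uncurry).map
            (Sym2.map (b ^ n • c + ·)) := by
        rw [List.map_map, List.map_map]
        rfl
      rw [this]
      exact ih.map (Sym2.map.injective (add_right_injective _))
    · refine hnd.imp fun {c c'} hne => ?_
      intro s hs hs'
      simp only [List.map_map, List.mem_map, Function.comp_apply] at hs hs'
      obtain ⟨e, he, rfl⟩ := hs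
      obtain ⟨e', he', heq⟩ := hs'
      have h1 := add_mem_cellRegion c (hreg e he).1
      have h2 := add_mem_cellRegion c (hreg e he).2
      have h1' := add_mem_cellRegion c' (hreg e' he').1
      have h2' := add_mem_cellRegion c' (hreg e' he').2
      have hee : b ^ n • c + e.1 ≠ b ^ n • c + e.2 := fun h =>
        ne_of_mem_edgeList hcs he (add_left_cancel h)
      refine hne ?_
      have heq : s(b ^ n • c' + e'.1, b ^ n • c' + e'.2) =
        s(b ^ n • c + e.1, b ^ n • c + e.2) := heq
      rcases Sym2.eq_iff.1 heq with ⟨h, h'⟩ | ⟨h, h'⟩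
      · exact eq_of_mem_cellRegion (Nat.pow_pos hb) hee h1 (h ▸ h1') h2 (h' ▸ h2')
      · exact eq_of_mem_cellRegion (Nat.pow_pos hb) hee h1 (h' ▸ h2') h2 (h ▸ h1')

end Edges

end SierpinskiGasket

/-! ### Only the partition matters, and only on the vertices still in use. -/

section SameOn

variable {V Λ Λ' : Type*}

/-- Two labellings induce the same partition of the vertices in `D`. -/
def SameOn (D : List V) (l : V → Λ) (l' : V → Λ') : Prop :=
  ∀ u ∈ D, ∀ v ∈ D, l u = l v ↔ l' u = l' v

theorem SameOn.trans {Λ'' : Type*} {D : List V} {l : V → Λ} {l' : V → Λ'} {l'' : V → Λ''}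
    (h : SameOn D l l') (h' : SameOn D l' l'') : SameOn D l l'' :=
  fun u hu v hv => (h u hu v hv).trans (h' u hu v hv)

theorem SameOn.joinCompatible {D : List V} {l : V → Λ} {l' : V → Λ'} (h : SameOn D l l')
    {a b c : V} (ha : a ∈ D) (hb : b ∈ D) (hc : c ∈ D) (i : Fin 5) :
    JoinCompatible a b c l i ↔ JoinCompatible a b c l' i :=
  match i with
  | 0 => Iff.rfl
  | 1 => not_congr (h a ha b hb)
  | 2 => not_congr (h a ha c hc)
  | 3 => not_congr (h b hb c hc)
  | 4 => and_congr (not_congr (h a ha b hb))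
      (and_congr (not_congr (h a ha c hc)) (not_congr (h b hb c hc)))

theorem joinCompatible_comp {W : Type*} (f : V → W) (a b c : V) (l : W → Λ) (i : Fin 5) :
    JoinCompatible a b c (l ∘ f) i ↔ JoinCompatible (f a) (f b) (f c) l i :=
  match i with
  | 0 | 1 | 2 | 3 | 4 => Iff.rfl

variable [DecidableEq Λ] [DecidableEq Λ']

theorem SameOn.mergeLabel {D : List V} {l : V → Λ} {l' : V → Λ'} (h : SameOn D l l') {a b : V}
    (ha : a ∈ D) (hb : b ∈ D) : SameOn D (mergeLabel a b l) (mergeLabel a b l') := by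
  intro u hu v hv
  simp only [_root_.mergeLabel, ← h u hu b hb, ← h v hv b hb]
  have h1 := h a ha v hv
  have h2 := h u hu a ha
  split_ifs <;> exact h _ ‹_› _ ‹_›

theorem sameOn_mergeLabel_comm (D : List V) (a b : V) (l : V → Λ) :
    SameOn D (mergeLabel a b l) (mergeLabel b a l) := by
  intro u _ v _
  simp only [_root_.mergeLabel]
  split_ifs <;> simp_all [eq_comm]

theorem SameOn.joinLabel {D : List V} {l : V → Λ} {l' : V → Λ'} (h : SameOn D l l') {a b c : V}
    (ha : a ∈ D) (hb : b ∈ D) (hc : c ∈ D) (i : Fin 5) :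
    SameOn D (joinLabel a b c l i) (joinLabel a b c l' i) :=
  match i with
  | 0 => h
  | 1 => h.mergeLabel ha hb
  | 2 => h.mergeLabel ha hc
  | 3 => h.mergeLabel hb hc
  | 4 => (h.mergeLabel ha hb).mergeLabel ha hc

theorem SameOn.labelIndex_eq {D : List V} {l : V → Λ} {l' : V → Λ'} (h : SameOn D l l')
    {a b c : V} (ha : a ∈ D) (hb : b ∈ D) (hc : c ∈ D) :
    labelIndex a b c l = labelIndex a b c l' := by
  simp only [labelIndex, h a ha b hb, h a ha c hc, h b hb c hc]

/-- This permits both renaming labels and forgetting vertices that no later triangle touches. -/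
theorem SameOn.glueSum_eq {D : List V} {φ : (V → Λ) → ℕ} {φ' : (V → Λ') → ℕ} (w : Fin 5 → ℕ)
    (hφ : ∀ l l', SameOn D l l' → φ l = φ' l') {ts : List (V × V × V)}
    (hts : ∀ t ∈ ts, t.1 ∈ D ∧ t.2.1 ∈ D ∧ t.2.2 ∈ D) {l : V → Λ} {l' : V → Λ'}
    (h : SameOn D l l') : glueSum w φ ts l = glueSum w φ' ts l' := by
  induction ts generalizing l l' with
  | nil => exact hφ l l' h
  | cons t ts ih =>
    obtain ⟨ha, hb, hc⟩ := hts t List.mem_cons_self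
    simp only [glueSum]
    refine Finset.sum_congr rfl fun i _ => ?_
    rw [ih (fun t ht => hts t (List.mem_cons_of_mem _ ht)) (h.joinLabel ha hb hc i)]
    simp only [h.joinCompatible ha hb hc i]

theorem joinLabel_comp {W : Type*} (f : V → W) (a b c : V) (l : W → Λ) (i : Fin 5) :
    joinLabel a b c (l ∘ f) i = joinLabel (f a) (f b) (f c) l i ∘ f :=
  match i with
  | 0 | 1 | 2 | 3 | 4 => rfl

theorem glueSum_comp {W : Type*} (f : V → W) (w : Fin 5 → ℕ) (φ : (V → Λ) → ℕ)
    (ts : List (V × V × V)) (l : W → Λ) :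
    glueSum w φ ts (l ∘ f) = glueSum w (fun l => φ (l ∘ f))
      (ts.map fun t => (f t.1, f t.2.1, f t.2.2)) l := by
  induction ts generalizing l with
  | nil => rfl
  | cons t ts ih =>
    simp only [glueSum, List.map_cons]
    refine Finset.sum_congr rfl fun i _ => ?_
    rw [joinLabel_comp, ih]
    simp only [joinCompatible_comp]

end SameOn

/-! ### A transfer-matrix evaluation of the gluing sum. -/

namespace GlueTable

/-! An evaluation of `glueSum` by a table of states with multiplicities. The vertices are the
multiples of `4` below `60`, and a labelling of them is stored in the base `16` digits of a number:
the vertex `k` has the digit at the bits from `k` on as its label. The functions are written with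
`List.rec` and in continuation passing style, so that the kernel evaluates them fast and evaluates
all numbers before they are copied. -/

/-- Evaluation of a number before it is used. -/
def force {α : Type} (n : ℕ) (k : ℕ → α) : α :=
  match n with
  | 0 => k 0
  | m + 1 => k (Nat.succ m)

theorem force_eq {α : Type} (n : ℕ) (k : ℕ → α) : force n k = k n := by
  cases n <;> rfl

/-- The label of the vertex `k`. -/
def label (s k : ℕ) : ℕ := Nat.land (Nat.shiftRight s k) 15

theorem label_eq (s k : ℕ) : label s k = s / 2 ^ k % 16 := by
  change (s >>> k) &&& (2 ^ 4 - 1) = _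
  rw [Nat.and_two_pow_sub_one_eq_mod, Nat.shiftRight_eq_div_pow]

theorem label_lt (s k : ℕ) : label s k < 16 := by
  rw [label_eq]
  exact Nat.mod_lt _ (by norm_num)

/-- The number whose base `16` digits are the values of `f` on a list. -/
noncomputable def encode (f : ℕ → ℕ) (ks : List ℕ) : ℕ :=
  List.rec 0 (fun k _ ih => Nat.add (f k) (Nat.mul 16 ih)) ks

theorem encode_cons (f : ℕ → ℕ) (k : ℕ) (ks : List ℕ) :
    encode f (k :: ks) = f k + 16 * encode f ks := rfl

theorem label_encode {f : ℕ → ℕ} (h : ∀ k, f k < 16) (ks : List ℕ) (j : ℕ) (hj : j < ks.length) :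
    label (encode f ks) (4 * j) = f ks[j] := by
  induction ks generalizing j with
  | nil => simp at hj
  | cons k ks ih =>
    have hk := h k
    rw [label_eq, encode_cons]
    cases j with
    | zero =>
      rw [List.getElem_cons_zero]
      omega
    | succ j =>
      rw [List.getElem_cons_succ, ← ih j (Nat.lt_of_succ_lt_succ hj), label_eq,
        show 4 * (j + 1) = 4 + 4 * j by ring, pow_add, ← Nat.div_div_eq_div_mul]
      congr 2
      omega

/-- The vertices. -/
def indices : List ℕ := [0, 4, 8, 12, 16, 20, 24, 28, 32, 36, 40, 44, 48, 52, 56]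

theorem label_encode_indices {f : ℕ → ℕ} (h : ∀ k, f k < 16) {k : ℕ} (hk : k ∈ indices) :
    label (encode f indices) k = f k := by
  obtain ⟨j, hj, rfl⟩ : ∃ j < 15, 4 * j = k := by
    revert k
    decide
  rw [label_encode h _ _ hj]
  congr 1
  interval_cases j <;> rfl

/-- Identify two labels; the larger one remains. -/
noncomputable def merge (a b s : ℕ) : ℕ :=
  force (label s a) fun x => force (label s b) fun y =>
    -- With initial labels increasing along the vertices, each class is labelled by its last vertex.
    -- If vertices are forgotten in increasing order, equal partitions of the remaining ones get
    -- equal states, which keeps the table small; correctness does not depend on this.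
    cond (Nat.ble y x)
      (encode (fun k => force (label s k) fun z => cond (Nat.beq z y) x z) indices)
      (encode (fun k => force (label s k) fun z => cond (Nat.beq z x) y z) indices)

theorem cond_beq {α : Type*} (m n : ℕ) (x y : α) :
    cond (Nat.beq m n) x y = if m = n then x else y := by
  by_cases h : m = n
  · rw [if_pos h, h, Nat.beq_refl]
    rfl
  · rw [if_neg h, Bool.eq_false_iff.2 fun h' => h (Nat.eq_of_beq_eq_true h')]
    rfl

theorem sameOn_merge {a b : ℕ} (ha : a ∈ indices) (hb : b ∈ indices) {s : ℕ} {l : ℕ → ℕ}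
    (h : SameOn indices (label s) l) :
    SameOn indices (label (merge a b s)) (mergeLabel a b l) := by
  refine SameOn.trans ?_ (h.mergeLabel ha hb)
  have key (x y : ℕ) (k : ℕ) (hk : k ∈ indices) :
      label (encode (fun k => if label s k = label s y then label s x else label s k) indices) k =
        mergeLabel x y (label s) k := by
    rw [label_encode_indices _ hk]
    · rfl
    · intro k
      split_ifs <;> exact label_lt _ _
  simp only [merge, force_eq, cond_beq]
  cases Nat.ble (label s b) (label s a)
  · refine SameOn.trans (fun u hu v hv => ?_) (sameOn_mergeLabel_comm indices b a (label s))
    rw [cond_false, key b a u hu, key b a v hv]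
  · intro u hu v hv
    rw [cond_true, key a b u hu, key a b v hv]

/-- The vertices whose labels are kept by a bit mask. -/
def kept (m : ℕ) : List ℕ := indices.filter fun k => label m k = 15

theorem sameOn_land (s m : ℕ) : SameOn (kept m) (label (Nat.land s m)) (label s) := by
  have key : ∀ k ∈ kept m, label (Nat.land s m) k = label s k := by
    intro k hk
    have hm : (m >>> k) &&& 15 = 15 := of_decide_eq_true (List.mem_filter.1 hk).2
    change ((s &&& m) >>> k) &&& 15 = (s >>> k) &&& 15
    rw [Nat.shiftRight_and_distrib, Nat.and_assoc, hm]
  intro u hu v hv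
  rw [key u hu, key v hv]

/-- Add a state with a multiplicity to a table. -/
noncomputable def insert {α : Type} (s x : ℕ) (T : List (ℕ × ℕ)) : (List (ℕ × ℕ) → α) → α :=
  List.rec (fun k => k [(s, x)])
    (fun p T ih k => cond (Nat.beq s p.1) (force (Nat.add x p.2) fun y => k ((p.1, y) :: T))
      (ih fun T' => k (p :: T'))) T

/-- The weighted sum of a function over a table. -/
def total (f : ℕ → ℕ) (T : List (ℕ × ℕ)) : ℕ := (T.map fun p => p.2 * f p.1).sum

theorem total_cons (f : ℕ → ℕ) (p : ℕ × ℕ) (T : List (ℕ × ℕ)) :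
    total f (p :: T) = p.2 * f p.1 + total f T := rfl

theorem total_singleton (f : ℕ → ℕ) (s : ℕ) : total f [(s, 1)] = f s := by
  simp [total]

/-- Undoes the continuation passing: one table serves all continuations, and only its weighted
totals matter. The same form is used for `insertIf` and `step`. -/
theorem exists_insert_eq (s x : ℕ) (T : List (ℕ × ℕ)) :
    ∃ T', (∀ (α : Type) (k : List (ℕ × ℕ) → α), insert s x T k = k T') ∧
      ∀ f, total f T' = x * f s + total f T := by
  induction T with
  | nil => exact ⟨_, fun _ _ => rfl, fun _ => rfl⟩
  | cons p T ih =>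
    obtain ⟨s', x'⟩ := p
    obtain ⟨T', h1, h2⟩ := ih
    have hcons (α : Type) (k : List (ℕ × ℕ) → α) : insert s x ((s', x') :: T) k =
      cond (Nat.beq s s') (force (Nat.add x x') fun y => k ((s', y) :: T))
        (insert s x T fun T' => k ((s', x') :: T')) := rfl
    by_cases h : s = s'
    · subst h
      refine ⟨(s, x + x') :: T, fun α k => ?_, fun f => ?_⟩
      · rw [hcons, cond_beq, if_pos rfl, force_eq]
        rfl
      · simp only [total_cons]
        ring
    · refine ⟨(s', x') :: T', fun α k => ?_, fun f => ?_⟩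
      · rw [hcons, cond_beq, if_neg h, h1]
      · simp only [total_cons, h2]
        ring

/-- Add the masked form of a state to a table, if a condition holds. -/
noncomputable def insertIf {α : Type} (p : Bool) (m s x : ℕ) (T : List (ℕ × ℕ))
    (k : List (ℕ × ℕ) → α) : α :=
  cond p (force s fun s => force (Nat.land s m) fun s => force x fun x => insert s x T k) (k T)

theorem exists_insertIf_eq (p : Bool) (m s x : ℕ) (T : List (ℕ × ℕ)) :
    ∃ T', (∀ (α : Type) (k : List (ℕ × ℕ) → α), insertIf p m s x T k = k T') ∧
      ∀ f, total f T' = (if p then x * f (Nat.land s m) else 0) + total f T := by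
  cases p
  · exact ⟨T, fun _ _ => rfl, fun f => by simp⟩
  · obtain ⟨T', h1, h2⟩ := exists_insert_eq (Nat.land s m) x T
    refine ⟨T', fun α k => ?_, fun f => ?_⟩
    · simp only [insertIf, cond_true, force_eq, h1]
    · simp [h2]

/-- Glue in a triangle with corners `a`, `b`, `c`, and keep the labels in the mask `m`. -/
noncomputable def step {α : Type} (w0 w1 w2 w3 w4 a b c m : ℕ) :
    List (ℕ × ℕ) → List (ℕ × ℕ) → (List (ℕ × ℕ) → α) → α
  | [], T, k => k T
  | (s, x) :: S, T, k =>
    force (label s a) fun la => force (label s b) fun lb => force (label s c) fun lc =>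
    insertIf true m s (Nat.mul w0 x) T fun T =>
    insertIf (!Nat.beq la lb) m (merge a b s) (Nat.mul w1 x) T fun T =>
    insertIf (!Nat.beq la lc) m (merge a c s) (Nat.mul w2 x) T fun T =>
    insertIf (!Nat.beq lb lc) m (merge b c s) (Nat.mul w3 x) T fun T =>
    insertIf (!Nat.beq la lb && (!Nat.beq la lc && !Nat.beq lb lc)) m
      (force (merge a b s) fun s => merge a c s) (Nat.mul w4 x) T fun T =>
    step w0 w1 w2 w3 w4 a b c m S T k

theorem not_beq {m n : ℕ} : (!Nat.beq m n) = true ↔ m ≠ n := by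
  rw [Bool.not_eq_true', ne_eq, ← Nat.beq_eq, Bool.not_eq_true]

theorem sum_joinCompatible {V Λ : Type*} [DecidableEq Λ] (w0 w1 w2 w3 w4 : ℕ) (a b c : V)
    (l : V → Λ) (f : (V → Λ) → ℕ) :
    ∑ i, ![w0, w1, w2, w3, w4] i *
        (if JoinCompatible a b c l i then f (joinLabel a b c l i) else 0) =
      w0 * f l + (if l a ≠ l b then w1 * f (mergeLabel a b l) else 0) +
        (if l a ≠ l c then w2 * f (mergeLabel a c l) else 0) +
        (if l b ≠ l c then w3 * f (mergeLabel b c l) else 0) +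
        (if l a ≠ l b ∧ l a ≠ l c ∧ l b ≠ l c then w4 * f (mergeLabel a c (mergeLabel a b l))
          else 0) := by
  simp only [← mul_ite_zero]
  exact Fin.sum_univ_five _

theorem exists_step_eq (w0 w1 w2 w3 w4 : ℕ) {a b c m : ℕ} (ha : a ∈ indices) (hb : b ∈ indices)
    (hc : c ∈ indices) {φ : (ℕ → ℕ) → ℕ} (hφ : ∀ l l', SameOn (kept m) l l' → φ l = φ l')
    (S T : List (ℕ × ℕ)) :
    ∃ T', (∀ (α : Type) (k : List (ℕ × ℕ) → α), step w0 w1 w2 w3 w4 a b c m S T k = k T') ∧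
      total (fun s => φ (label s)) T' = total (fun s => ∑ i, ![w0, w1, w2, w3, w4] i *
        if JoinCompatible a b c (label s) i then φ (joinLabel a b c (label s) i) else 0) S +
        total (fun s => φ (label s)) T := by
  induction S generalizing T with
  | nil => exact ⟨T, fun _ _ => rfl, (zero_add _).symm⟩
  | cons p S ih =>
    obtain ⟨s, x⟩ := p
    obtain ⟨T0, h0, h0'⟩ := exists_insertIf_eq true m s (Nat.mul w0 x) T
    obtain ⟨T1, h1, h1'⟩ := exists_insertIf_eq (!Nat.beq (label s a) (label s b)) m (merge a b s)
      (Nat.mul w1 x) T0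
    obtain ⟨T2, h2, h2'⟩ := exists_insertIf_eq (!Nat.beq (label s a) (label s c)) m (merge a c s)
      (Nat.mul w2 x) T1
    obtain ⟨T3, h3, h3'⟩ := exists_insertIf_eq (!Nat.beq (label s b) (label s c)) m (merge b c s)
      (Nat.mul w3 x) T2
    obtain ⟨T4, h4, h4'⟩ := exists_insertIf_eq (!Nat.beq (label s a) (label s b) &&
      (!Nat.beq (label s a) (label s c) && !Nat.beq (label s b) (label s c))) m
      (merge a c (merge a b s)) (Nat.mul w4 x) T3
    obtain ⟨T5, h5, h5'⟩ := ih T4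
    refine ⟨T5, fun α k => ?_, ?_⟩
    · simp only [step, force_eq, h0, h1, h2, h3, h4, h5]
    · have hrefl : SameOn indices (label s) (label s) := fun _ _ _ _ => Iff.rfl
      have hm {t : ℕ} {l : ℕ → ℕ} (h : SameOn indices (label t) l) :
          φ (label (Nat.land t m)) = φ l :=
        hφ _ _ ((sameOn_land t m).trans fun u hu v hv =>
          h u (List.mem_of_mem_filter hu) v (List.mem_of_mem_filter hv))
      rw [h5', h4', h3', h2', h1', h0', total_cons, sum_joinCompatible, hm hrefl,
        hm (sameOn_merge ha hb hrefl), hm (sameOn_merge ha hc hrefl),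
        hm (sameOn_merge hb hc hrefl), hm (sameOn_merge ha hc (sameOn_merge ha hb hrefl))]
      generalize total (fun s => ∑ i : Fin 5, _) S = z
      simp only [Bool.and_eq_true, not_beq, Nat.mul_eq, if_true, mul_add, mul_ite, mul_zero]
      simp only [mul_assoc, mul_left_comm x]
      ring

/-- Glue in triangles one after the other. -/
noncomputable def run (w0 w1 w2 w3 w4 : ℕ) :
    List ((ℕ × ℕ × ℕ) × ℕ) → List (ℕ × ℕ) → List (ℕ × ℕ)
  | [], T => T
  | ((a, b, c), m) :: p, T => step w0 w1 w2 w3 w4 a b c m T [] (run w0 w1 w2 w3 w4 p)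

/-- The masks keep the vertices that are still needed, and the vertices in `F`. -/
def Valid (F : List ℕ) (p : List ((ℕ × ℕ × ℕ) × ℕ)) : Prop :=
  (∀ q ∈ p, (q.1.1 ∈ indices ∧ q.1.2.1 ∈ indices ∧ q.1.2.2 ∈ indices) ∧ ∀ u ∈ F, u ∈ kept q.2) ∧
    p.Pairwise fun q q' => q'.1.1 ∈ kept q.2 ∧ q'.1.2.1 ∈ kept q.2 ∧ q'.1.2.2 ∈ kept q.2

/-- After each step, the rest of the sum depends only on vertices kept by the mask, by `Valid`; so
replacing states by their masked forms and merging equal entries leaves the total unchanged. -/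
theorem total_run (w0 w1 w2 w3 w4 : ℕ) {F : List ℕ} {φ : (ℕ → ℕ) → ℕ}
    (hφ : ∀ l l', SameOn F l l' → φ l = φ l') {p : List ((ℕ × ℕ × ℕ) × ℕ)} (hp : Valid F p)
    (T : List (ℕ × ℕ)) :
    total (fun s => φ (label s)) (run w0 w1 w2 w3 w4 p T) =
      total (fun s => glueSum ![w0, w1, w2, w3, w4] φ (p.map Prod.fst) (label s)) T := by
  induction p generalizing T with
  | nil => rfl
  | cons q p ih =>
    obtain ⟨⟨a, b, c⟩, m⟩ := q
    obtain ⟨hp1, hp2⟩ := hp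
    obtain ⟨⟨ha, hb, hc⟩, hF⟩ := hp1 _ List.mem_cons_self
    rw [List.pairwise_cons] at hp2
    obtain ⟨hq, hp2⟩ := hp2
    have hp : Valid F p := ⟨fun q hq => hp1 q (List.mem_cons_of_mem _ hq), hp2⟩
    have hψ : ∀ l l' : ℕ → ℕ, SameOn (kept m) l l' →
        glueSum ![w0, w1, w2, w3, w4] φ (p.map Prod.fst) l =
          glueSum ![w0, w1, w2, w3, w4] φ (p.map Prod.fst) l' := by
      intro l l' h
      refine SameOn.glueSum_eq _ (fun l l' h => hφ l l' fun u hu v hv =>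
        h u (hF u hu) v (hF v hv)) ?_ h
      intro t ht
      obtain ⟨q, hqp, rfl⟩ := List.mem_map.1 ht
      exact hq q hqp
    obtain ⟨T', h1, h2⟩ := exists_step_eq w0 w1 w2 w3 w4 ha hb hc hψ T []
    rw [run, h1, ih hp, h2]
    exact add_zero _

/-- The table entries by partition of the three vertices `a`, `b`, `c`. -/
def collect (a b c : ℕ) : List (ℕ × ℕ) → ℕ → ℕ → ℕ → ℕ → ℕ → ℕ × ℕ × ℕ × ℕ × ℕ
  | [], x0, x1, x2, x3, x4 => (x0, x1, x2, x3, x4)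
  | (s, x) :: T, x0, x1, x2, x3, x4 =>
    cond (Nat.beq (label s a) (label s b))
      (cond (Nat.beq (label s a) (label s c))
        (force (Nat.add x x4) fun y => collect a b c T x0 x1 x2 x3 y)
        (force (Nat.add x x1) fun y => collect a b c T x0 y x2 x3 x4))
      (cond (Nat.beq (label s a) (label s c))
        (force (Nat.add x x2) fun y => collect a b c T x0 x1 y x3 x4)
        (cond (Nat.beq (label s b) (label s c))
          (force (Nat.add x x3) fun y => collect a b c T x0 x1 x2 y x4)
          (force (Nat.add x x0) fun y => collect a b c T y x1 x2 x3 x4)))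

/-- The multiplicity in a table of the states with a given partition of `a`, `b`, `c`. -/
def count (a b c : ℕ) (T : List (ℕ × ℕ)) (i : Fin 5) : ℕ :=
  total (fun s => if labelIndex a b c (label s) = i then 1 else 0) T

theorem collect_eq (a b c : ℕ) (T : List (ℕ × ℕ)) (x0 x1 x2 x3 x4 : ℕ) :
    collect a b c T x0 x1 x2 x3 x4 = (count a b c T 0 + x0, count a b c T 1 + x1,
      count a b c T 2 + x2, count a b c T 3 + x3, count a b c T 4 + x4) := by
  induction T generalizing x0 x1 x2 x3 x4 with
  | nil => simp [collect, count, total]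
  | cons p T ih =>
    obtain ⟨s, x⟩ := p
    have hcons (i : Fin 5) : count a b c ((s, x) :: T) i =
        (if labelIndex a b c (label s) = i then x else 0) + count a b c T i := by
      rw [count, total_cons]
      simp only [mul_ite, mul_one, mul_zero]
      rfl
    simp only [collect, cond_beq, force_eq, ih, hcons, labelIndex, Nat.add_eq]
    split_ifs <;> simp <;> omega

end GlueTable

/-! ### The gluing program for side length four. -/

namespace SierpinskiGasket

/-- The positions of the triangles of a gasket of side length `4`, in the order of gluing. -/
def cellList : List (ℕ × ℕ) :=
  [(0, 0), (0, 1), (0, 2), (0, 3), (1, 0), (1, 1), (1, 2), (2, 0), (2, 1), (3, 0)]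

theorem nodup_cellList : cellList.Nodup := by decide

theorem mem_cellList_iff (c : ℕ × ℕ) : c ∈ cellList ↔ c ∈ cells 4 := by
  rw [← List.mem_toFinset, show cellList.toFinset = cells 4 by decide]

/-- The vertices of the first stage, with the corners at the end. -/
def vertexList : List (ℕ × ℕ) :=
  [(0, 1), (0, 2), (0, 3), (1, 0), (1, 1), (1, 2), (1, 3), (2, 0),
    (2, 1), (2, 2), (3, 0), (3, 1), (0, 0), (4, 0), (0, 4)]

/-- The place of the label of a vertex in `GlueTable.label`. -/
def vertexIndex (p : ℕ × ℕ) : ℕ := 4 * vertexList.idxOf p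

/-- The gluing of the triangles in `cellList`. -/
def program : List ((ℕ × ℕ × ℕ) × ℕ) :=
  [((48, 12, 0), 1152921504606846975),
    ((0, 16, 4), 1152921504606846960),
    ((4, 20, 8), 1152921504606846720),
    ((8, 24, 56), 1152921504606842880),
    ((12, 28, 16), 1152921504606781440),
    ((16, 32, 20), 1152921504605798400),
    ((20, 36, 24), 1152921504338411520),
    ((28, 40, 32), 1152921500311879680),
    ((32, 44, 36), 1152920405095219200),
    ((40, 52, 44), 1152640029630136320)]

/-- The state with different labels for all vertices. -/
def initialState : ℕ := 1070935975390360080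

/-- Each mask has all sixty bits set except the lowest digits, those of the vertices in no later
triangle. The large corners come last in `vertexList`, so they are never dropped. -/
theorem valid_program : GlueTable.Valid [48, 52, 56] program := by
  unfold GlueTable.Valid
  decide +kernel

theorem map_cellCorners_cellList :
    (cellList.map cellCorners).map (fun t => (vertexIndex t.1, vertexIndex t.2.1,
      vertexIndex t.2.2)) = program.map Prod.fst := by
  decide

/-- In hexadecimal the state is `0xEDCBA9876543210`: the vertex at place `j` has label `j`. -/
theorem sameOn_initialState :
    SameOn vertexList (id : ℕ × ℕ → ℕ × ℕ) (GlueTable.label initialState ∘ vertexIndex) := by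
  unfold SameOn
  decide

theorem cellCorners_subset :
    ∀ t ∈ cellList.map cellCorners, t.1 ∈ vertexList ∧ t.2.1 ∈ vertexList ∧ t.2.2 ∈ vertexList := by
  decide

/-- The numbers of spanning forests of the gasket by the partition of the corners. -/
noncomputable def weights (n : ℕ) : Fin 5 → ℕ := cornerCount (4 ^ n) (edgeList 4 cellList n)

theorem edgeList_cellList_subset (n : ℕ) : ∀ e ∈ edgeList 4 cellList n,
    e.1 ∈ cellRegion (4 ^ n) 0 ∧ e.2 ∈ cellRegion (4 ^ n) 0 :=
  edgeList_subset_cellRegion (fun c hc => (mem_cellList_iff c).1 hc) n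

theorem weights_succ (n : ℕ) (i : Fin 5) :
    weights (n + 1) i = glueSum (weights n)
      (fun l => if labelIndex (0, 0) (4, 0) (0, 4) l = i then 1 else 0)
      (cellList.map cellCorners) (id : ℕ × ℕ → ℕ × ℕ) := by
  rw [weights, pow_succ', edgeList]
  exact cornerCount_glueEdges (by positivity) (edgeList_cellList_subset n) nodup_cellList
    Function.injective_id i

theorem numSpanningForests_graph (n : ℕ) :
    numSpanningForests (graph 4 n) = ∑ i, weights n i := by
  rw [weights, cornerCount, sum_triangleCount]
  refine numSpanningForests_eq_indepSum _ _ ?_ ?_ ?_ ?_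
  · exact fun e he => mem_vertices_of_mem_edgeList (fun c hc => (mem_cellList_iff c).1 hc) he
  · exact fun e he => ne_of_mem_edgeList mem_cellList_iff he
  · exact nodup_edgeList (by norm_num) nodup_cellList mem_cellList_iff n
  · exact fun a b => edge_iff_mem_edgeList mem_cellList_iff

/-- The partition counts of the next stage, computed from those of a stage. -/
noncomputable def nextWeights (w0 w1 w2 w3 w4 : ℕ) : ℕ × ℕ × ℕ × ℕ × ℕ :=
  GlueTable.collect 48 52 56 (GlueTable.run w0 w1 w2 w3 w4 program [(initialState, 1)]) 0 0 0 0 0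

/-- The identity labelling of lattice points is exchanged for the encoded one, which is injective on
the fifteen vertices that occur, and the gluing is then carried over to the indices. -/
theorem weights_succ_eq_count {n w0 w1 w2 w3 w4 : ℕ} (h : weights n = ![w0, w1, w2, w3, w4])
    (i : Fin 5) :
    weights (n + 1) i = GlueTable.count 48 52 56
      (GlueTable.run w0 w1 w2 w3 w4 program [(initialState, 1)]) i := by
  have hφ : (fun l : ℕ → ℕ =>
      if labelIndex (0, 0) (4, 0) (0, 4) (l ∘ vertexIndex) = i then 1 else 0) =
      fun l => if labelIndex 48 52 56 l = i then 1 else 0 := by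
    have h0 : vertexIndex (0, 0) = 48 := by decide
    have h1 : vertexIndex (4, 0) = 52 := by decide
    have h2 : vertexIndex (0, 4) = 56 := by decide
    funext l
    rw [show labelIndex (0, 0) (4, 0) (0, 4) (l ∘ vertexIndex) = labelIndex 48 52 56 l by
      simp only [labelIndex, Function.comp_apply, h0, h1, h2]]
  calc weights (n + 1) i = glueSum (weights n)
        (fun l => if labelIndex (0, 0) (4, 0) (0, 4) l = i then 1 else 0)
        (cellList.map cellCorners) (id : ℕ × ℕ → ℕ × ℕ) := weights_succ n i
    _ = glueSum ![w0, w1, w2, w3, w4]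
        (fun l => if labelIndex (0, 0) (4, 0) (0, 4) l = i then 1 else 0)
        (cellList.map cellCorners) (GlueTable.label initialState ∘ vertexIndex) := by
      rw [h]
      refine SameOn.glueSum_eq _ ?_ cellCorners_subset sameOn_initialState
      intro l l' h
      rw [h.labelIndex_eq (by decide) (by decide) (by decide)]
    _ = glueSum ![w0, w1, w2, w3, w4] (fun l => if labelIndex 48 52 56 l = i then 1 else 0)
        (program.map Prod.fst) (GlueTable.label initialState) := by
      rw [glueSum_comp, map_cellCorners_cellList, hφ]
    _ = GlueTable.total (fun s => glueSum ![w0, w1, w2, w3, w4]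
          (fun l => if labelIndex 48 52 56 l = i then 1 else 0) (program.map Prod.fst)
          (GlueTable.label s)) [(initialState, 1)] := by
      rw [GlueTable.total_singleton]
    _ = GlueTable.total (fun s => if labelIndex 48 52 56 (GlueTable.label s) = i then 1 else 0)
        (GlueTable.run w0 w1 w2 w3 w4 program [(initialState, 1)]) := by
      refine (GlueTable.total_run w0 w1 w2 w3 w4 (F := [48, 52, 56])
        (φ := fun l => if labelIndex 48 52 56 l = i then 1 else 0) ?_ valid_program
          [(initialState, 1)]).symm
      intro l l' h
      rw [h.labelIndex_eq (by decide) (by decide) (by decide)]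
    _ = _ := by rw [GlueTable.count]

theorem weights_succ_of_nextWeights {n w0 w1 w2 w3 w4 v0 v1 v2 v3 v4 : ℕ}
    (h : weights n = ![w0, w1, w2, w3, w4])
    (h' : nextWeights w0 w1 w2 w3 w4 = (v0, v1, v2, v3, v4)) :
    weights (n + 1) = ![v0, v1, v2, v3, v4] := by
  rw [nextWeights, GlueTable.collect_eq] at h'
  simp only [Prod.mk.injEq, add_zero] at h'
  obtain ⟨h0, h1, h2, h3, h4⟩ := h'
  funext i
  rw [weights_succ_eq_count h]
  match i with
  | 0 => exact h0
  | 1 => exact h1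
  | 2 => exact h2
  | 3 => exact h3
  | 4 => exact h4

theorem nextWeights_eq_of_beq {w0 w1 w2 w3 w4 : ℕ} {v : ℕ × ℕ × ℕ × ℕ × ℕ}
    (h : (nextWeights w0 w1 w2 w3 w4 == v) = true) : nextWeights w0 w1 w2 w3 w4 = v :=
  eq_of_beq h

end SierpinskiGasket

/-! ### Bounds for the gluing sum and the exact weights of the first stages. -/

section GlueSum

variable {V Λ : Type*} [DecidableEq Λ]

/-- Dropping the cycle conditions leaves a product of independent choices. -/
theorem glueSum_le (w : Fin 5 → ℕ) (ts : List (V × V × V)) (l : V → Λ) :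
    glueSum w (fun _ => 1) ts l ≤ (∑ i, w i) ^ ts.length := by
  induction ts generalizing l with
  | nil => rfl
  | cons t ts ih =>
    rw [glueSum, List.length_cons, pow_succ', Finset.sum_mul]
    refine Finset.sum_le_sum fun i _ => Nat.mul_le_mul_left _ ?_
    split_ifs
    · exact ih _
    · exact Nat.zero_le _

/-- Only the term is kept in which every triangle carries the separating partition; it is always
compatible and changes no label. -/
theorem pow_mul_le_glueSum (w : Fin 5 → ℕ) (φ : (V → Λ) → ℕ) (ts : List (V × V × V)) (l : V → Λ) :
    w 0 ^ ts.length * φ l ≤ glueSum w φ ts l := by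
  induction ts with
  | nil => exact (one_mul _).le
  | cons t ts ih =>
    rw [glueSum, List.length_cons, pow_succ', mul_assoc]
    refine (Nat.mul_le_mul_left _ ih).trans ?_
    exact Finset.single_le_sum (f := fun i => w i * if JoinCompatible t.1 t.2.1 t.2.2 l i then
      glueSum w φ ts (joinLabel t.1 t.2.1 t.2.2 l i) else 0) (fun _ _ => Nat.zero_le _)
      (Finset.mem_univ 0)

theorem sum_glueSum_eq (w : Fin 5 → ℕ) (f : (V → Λ) → Fin 5) (ts : List (V × V × V)) (l : V → Λ) :
    ∑ i, glueSum w (fun l => if f l = i then 1 else 0) ts l = glueSum w (fun _ => 1) ts l := by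
  induction ts generalizing l with
  | nil => simp [glueSum]
  | cons t ts ih =>
    simp only [glueSum]
    rw [Finset.sum_comm]
    refine Finset.sum_congr rfl fun j _ => ?_
    rw [← Finset.mul_sum, ← ih]
    split_ifs
    · rfl
    · simp

/-- The evaluation of `indepSum` on edges by means of labels. -/
def labelSum (φ : (V → Λ) → ℕ) : List (V × V) → (V → Λ) → ℕ
  | [], l => φ l
  | e :: es, l => labelSum φ es l +
      if l e.1 = l e.2 then 0 else labelSum φ es (mergeLabel e.1 e.2 l)

theorem indepSum_labelSpace (φ : Submodule (ZMod 2) (V →₀ ZMod 2) → ℕ) (es : List (V × V))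
    (l : V → Λ) :
    indepSum φ (es.map edgeVec) (labelSpace l) = labelSum (fun l => φ (labelSpace l)) es l := by
  classical
  induction es generalizing l with
  | nil => rfl
  | cons e es ih =>
    obtain ⟨u, v⟩ := e
    rw [List.map_cons, indepSum, labelSum, ih, ← labelSpace_mergeLabel, ih]
    congr 1
    exact if_congr edgeVec_mem_labelSpace rfl rfl

end GlueSum

namespace SierpinskiGasket

/-- Of the eight edge sets of a triangle, only the full one has a cycle; the three sets with two
edges all connect the three corners. -/
theorem weights_zero : weights 0 = ![1, 1, 1, 1, 3] := by
  classical
  have key (i : Fin 5) : weights 0 i =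
      labelSum (fun l => if labelIndex (0, 0) (1, 0) (0, 1) l = i then 1 else 0)
        [((0, 0), (1, 0)), ((0, 0), (0, 1)), ((1, 0), (0, 1))] (id : ℕ × ℕ → ℕ × ℕ) := by
    have := indepSum_labelSpace
      (fun W => if triangleIndex (edgeVec ((0, 0), (1, 0))) (edgeVec ((0, 0), (0, 1))) W = i
        then 1 else 0) [((0, 0), (1, 0)), ((0, 0), (0, 1)), ((1, 0), (0, 1))]
      (id : ℕ × ℕ → ℕ × ℕ)
    simp only [triangleIndex_labelSpace] at this
    rw [← this, labelSpace_of_injective Function.injective_id]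
    change indepSum _ _ _ = indepSum _ _ _
    congr!
  funext i
  rw [key]
  revert i
  decide

theorem weights_one : weights 1 = ![44023375, 8406453, 8406453, 8406453, 6665475] :=
  weights_succ_of_nextWeights weights_zero (nextWeights_eq_of_beq (by decide +kernel))

theorem weights_two : weights 2 = ![5999909720181025298050651626022102167639644629745310599996325091978348857528331, 17447838129920655302865270986884479355572603291172150410900983156421717259395, 17447838129920655302865270986884479355572603291172150410900983156421717259395, 17447838129920655302865270986884479355572603291172150410900983156421717259395, 772069425849585011183346692712538703294972628973372161275424155207555217357] :=
  weights_succ_of_nextWeights weights_one (nextWeights_eq_of_beq (by decide +kernel))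

theorem weights_three : weights 3 = ![66027495332149962722528596863151503105920525443917302030304477837633302726439834239539469671749912155894106417249953158454021547319425490040211799124613924595653204982515158504355255025428272748601435419998868552111084577614634846965454643614147126572442116734356964670157660865958949166072183377338432852491722330280812190252419319422540922035220552954417174264203106821036801137602147849356215687676195307501947909101412439514782688276100681076278511850737412456648111152090518944664549703159940383204953963930553951745547651102287470764278637782745400188748267382543503229493881454098222395995495357778618770865054197068201635499846427254774758744980584755076631810631121840434912318474832580658469293608081657009340127987392810502874073647052575651246291330430829783409343647004259007, 5518237868553042373908302236182537624512356061903693796434722348753522850985658157219015776092548813571242353923510257276159009112117667253073868648855911688892752807572092929336189506496491920015529018311614982954731306810278650670553372154051734123902672298197842038895239506447169907665680429613873735413214472812833103792272951895587746523261497042560170288315389197341804747098026366951064408405772086471106429745680241473255785442719082229579476396596871892839296780855975457434617703336073852886298268743329758465493473649719874194606814433997581009557403766285389453175513733640169887696870254198668427216701596806169772730268412639638378513556432015372534305531930522493323705690284474888632145625205779667663011148616220080415528391868834083665354344925092706891118129, 5518237868553042373908302236182537624512356061903693796434722348753522850985658157219015776092548813571242353923510257276159009112117667253073868648855911688892752807572092929336189506496491920015529018311614982954731306810278650670553372154051734123902672298197842038895239506447169907665680429613873735413214472812833103792272951895587746523261497042560170288315389197341804747098026366951064408405772086471106429745680241473255785442719082229579476396596871892839296780855975457434617703336073852886298268743329758465493473649719874194606814433997581009557403766285389453175513733640169887696870254198668427216701596806169772730268412639638378513556432015372534305531930522493323705690284474888632145625205779667663011148616220080415528391868834083665354344925092706891118129,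 5518237868553042373908302236182537624512356061903693796434722348753522850985658157219015776092548813571242353923510257276159009112117667253073868648855911688892752807572092929336189506496491920015529018311614982954731306810278650670553372154051734123902672298197842038895239506447169907665680429613873735413214472812833103792272951895587746523261497042560170288315389197341804747098026366951064408405772086471106429745680241473255785442719082229579476396596871892839296780855975457434617703336073852886298268743329758465493473649719874194606814433997581009557403766285389453175513733640169887696870254198668427216701596806169772730268412639638378513556432015372534305531930522493323705690284474888632145625205779667663011148616220080415528391868834083665354344925092706891118129, 187502157300327491440244485967973872540693105149842452357647965401458555513929874753813062323938778986888129534958860903929512665817721262913488755015190959175266531369955399731951820314859971953813562188812855458698534471173403989556764918975107245349256681862589891147880775388027888903203130032000728994704751169082179406262812809257804514986204553960451972511026675166436336126826702098187374483894205939763315781827720759373413572854253613548386848518039469955263817904325264275158015714951024069177193488944513538040853114259516439003399249163501013806808516721976648335622312370971379958363144864248045505337024473513018999091428488332976946338517556675084220978061592131577723589299295430455397157754711775918912592105470984245350091068793124598037930532367570031] :=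
  weights_succ_of_nextWeights weights_two (nextWeights_eq_of_beq (by decide +kernel))

theorem sum_weights_succ_le (n : ℕ) : ∑ i, weights (n + 1) i ≤ (∑ i, weights n i) ^ 10 := by
  simp only [weights_succ, sum_glueSum_eq]
  exact glueSum_le _ _ _

theorem pow_weights_zero_le (n : ℕ) : weights n 0 ^ 10 ≤ weights (n + 1) 0 := by
  rw [weights_succ]
  exact (mul_one _).symm.le.trans (pow_mul_le_glueSum (weights n)
    (fun l => if labelIndex (0, 0) (4, 0) (0, 4) l = 0 then 1 else 0)
    (cellList.map cellCorners) (id : ℕ × ℕ → ℕ × ℕ))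

theorem weights_zero_pos (n : ℕ) : 0 < weights n 0 := by
  induction n with
  | zero => rw [weights_zero]; exact Nat.one_pos
  | succ n ih => exact (Nat.pow_pos ih).trans_le (pow_weights_zero_le n)

theorem weights_zero_le_sum (n : ℕ) : weights n 0 ≤ ∑ i, weights n i :=
  Finset.single_le_sum (fun _ _ => Nat.zero_le _) (Finset.mem_univ 0)

end SierpinskiGasket

/-! ### Enclosing the logarithms and passing to the limit. -/

namespace SierpinskiGasket

/-- Taking `k`-th roots makes the argument of `exp` small enough for a short Taylor sum; the decimal
`p / 10 ^ e` separates the two sides, leaving one comparison of integers for the kernel. -/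
theorem le_log_of_exp_div_le {x : ℝ} {p e k N : ℕ} (hk : k ≠ 0) (hN : 0 < N)
    (hx : Real.exp (x / k) ≤ p / 10 ^ e)
    (h : Nat.ble (Nat.pow p k) (Nat.mul N (Nat.pow 10 (e * k))) = true) :
    x ≤ Real.log N := by
  have h' : p ^ k ≤ N * 10 ^ (e * k) := Nat.le_of_ble_eq_true h
  rw [Real.le_log_iff_exp_le (by exact_mod_cast hN)]
  calc Real.exp x = Real.exp (x / k) ^ k := by
        rw [← Real.exp_nat_mul, mul_div_cancel₀ _ (by exact_mod_cast hk)]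
    _ ≤ (p / 10 ^ e : ℝ) ^ k := pow_le_pow_left₀ (Real.exp_pos _).le hx _
    _ ≤ _ := by
      rw [div_pow, ← pow_mul, div_le_iff₀ (by positivity)]
      exact_mod_cast h'

theorem log_le_of_le_exp_div {x : ℝ} {p e k N : ℕ} (hk : k ≠ 0) (hN : 0 < N)
    (hx : (p / 10 ^ e : ℝ) ≤ Real.exp (x / k))
    (h : Nat.ble (Nat.mul N (Nat.pow 10 (e * k))) (Nat.pow p k) = true) :
    Real.log N ≤ x := by
  have h' : N * 10 ^ (e * k) ≤ p ^ k := Nat.le_of_ble_eq_true h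
  rw [Real.log_le_iff_le_exp (by exact_mod_cast hN)]
  calc (N : ℝ) ≤ (p / 10 ^ e : ℝ) ^ k := by
        rw [div_pow, ← pow_mul, le_div_iff₀ (by positivity)]
        exact_mod_cast h'
    _ ≤ Real.exp (x / k) ^ k := pow_le_pow_left₀ (by positivity) hx _
    _ = Real.exp x := by
        rw [← Real.exp_nat_mul, mul_div_cancel₀ _ (by exact_mod_cast hk)]

/-- The constants here and in `log_sum_weights_three_le` are `4000 / 3` times the two claimed
bounds, rounded inwards. -/
theorem le_log_weights_three : (1814.0219543334 : ℝ) ≤ Real.log (weights 3 0) := by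
  have hw : weights 3 0 =
      66027495332149962722528596863151503105920525443917302030304477837633302726439834239539469671749912155894106417249953158454021547319425490040211799124613924595653204982515158504355255025428272748601435419998868552111084577614634846965454643614147126572442116734356964670157660865958949166072183377338432852491722330280812190252419319422540922035220552954417174264203106821036801137602147849356215687676195307501947909101412439514782688276100681076278511850737412456648111152090518944664549703159940383204953963930553951745547651102287470764278637782745400188748267382543503229493881454098222395995495357778618770865054197068201635499846427254774758744980584755076631810631121840434912318474832580658469293608081657009340127987392810502874073647052575651246291330430829783409343647004259007 := by
    rw [weights_three]
    rfl
  -- Division by `4096` gives an argument near `0.4429`, inside the interval from `0` to `1` where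
  -- `Real.exp_bound'` applies.
  refine le_log_of_exp_div_le (p := 15571799386289948) (e := 16) (k := 4096) (by norm_num)
    (weights_zero_pos 3) ?_ ?_
  · refine (Real.exp_bound' (by norm_num) (by norm_num) (n := 16) (by norm_num)).trans ?_
    norm_num [Finset.sum_range_succ, Nat.factorial]
  · rw [hw]
    decide +kernel

theorem log_sum_weights_three_le :
    Real.log ((∑ i, weights 3 i : ℕ) : ℝ) ≤ (1814.0219543466 : ℝ) := by
  have hw : ∑ i, weights 3 i =
      66027495348704676515689881285203901254712624285428242756708664376779922130348368193954999657336834237984815181902459207112681854106763421306077466701556793455709695064384376102338065183392241000042731494905427560859491715291684226094825066799211232591362238081172226914007868845234558833294468488363363044536473568521184603395669799881539183984796601782006180378088171646434941240654237257086630915356090630906638652408937668515139194523588796777849331393729455194825575348647879242496293979789057768371191237540472827152730415443281429754291374626082282494140259574716728335158566535601411932538317391840609491824204342966351931255380218958598995755324208628722874195266281432114924864016395829307046307573273524340354624745093619867635325993770145072202884650220017416222552300045183425 := by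
    rw [weights_three, Fin.sum_univ_five]
    rfl
  refine log_le_of_le_exp_div (p := 15571799386340130) (e := 16) (k := 4096) (by norm_num)
    ((weights_zero_pos 3).trans_le (weights_zero_le_sum 3)) ?_ ?_
  · refine le_trans ?_ (Real.sum_le_exp_of_nonneg (by norm_num) 16)
    norm_num [Finset.sum_range_succ, Nat.factorial]
  · rw [hw]
    decide +kernel

theorem antitone_log_sum_weights :
    Antitone fun n => Real.log ((∑ i, weights n i : ℕ) : ℝ) / 10 ^ n := by
  refine antitone_nat_of_succ_le fun n => ?_
  have hpos : 0 < ∑ i, weights (n + 1) i :=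
    (weights_zero_pos _).trans_le (weights_zero_le_sum _)
  have h : Real.log ((∑ i, weights (n + 1) i : ℕ) : ℝ) ≤
      10 * Real.log ((∑ i, weights n i : ℕ) : ℝ) := by
    refine (Real.log_le_log (by exact_mod_cast hpos)
      (Nat.cast_le.2 (sum_weights_succ_le n))).trans ?_
    rw [Nat.cast_pow, Real.log_pow]
    norm_num
  rw [div_le_div_iff₀ (by positivity) (by positivity), pow_succ]
  nlinarith [show (0 : ℝ) < 10 ^ n by positivity]

theorem monotone_log_weights_zero : Monotone fun n => Real.log (weights n 0) / 10 ^ n := by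
  refine monotone_nat_of_le_succ fun n => ?_
  have hpos := weights_zero_pos n
  have h : 10 * Real.log (weights n 0) ≤ Real.log (weights (n + 1) 0) := by
    refine le_trans ?_ (Real.log_le_log (by positivity)
      (Nat.cast_le.2 (pow_weights_zero_le n)))
    rw [Nat.cast_pow, Real.log_pow]
    norm_num
  rw [div_le_div_iff₀ (by positivity) (by positivity), pow_succ]
  nlinarith [show (0 : ℝ) < 10 ^ n by positivity]

theorem log_weights_zero_le (n : ℕ) :
    Real.log (weights n 0) / 10 ^ n ≤ Real.log ((∑ i, weights n i : ℕ) : ℝ) / 10 ^ n := by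
  have hpos := weights_zero_pos n
  gcongr
  exact weights_zero_le_sum n

theorem card_vertices_four (n : ℕ) :
    (Fintype.card {p : ℕ × ℕ // p ∈ vertices 4 n} : ℝ) = (4 * 10 ^ n + 5) / 3 := by
  have h : (3 * (vertices 4 n).card : ℝ) = 4 * 10 ^ n + 5 := by
    exact_mod_cast three_mul_card_vertices_four n
  rw [Fintype.card_coe]
  linarith

theorem tendsto_card_vertices_four :
    Tendsto (fun n => Fintype.card {p : ℕ × ℕ // p ∈ vertices 4 n}) atTop atTop := by
  refine tendsto_atTop_mono (fun n => ?_) tendsto_id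
  have h := three_mul_card_vertices_four n
  have h' : n < 10 ^ n := Nat.lt_pow_self (by norm_num)
  rw [Fintype.card_coe, id]
  omega

theorem tendsto_pow_div_card :
    Tendsto (fun n => (10 : ℝ) ^ n / Fintype.card {p : ℕ × ℕ // p ∈ vertices 4 n}) atTop
      (𝓝 (3 / 4)) := by
  have h : Tendsto (fun n : ℕ => 3 / (4 + 5 * ((10 : ℝ)⁻¹) ^ n)) atTop (𝓝 (3 / (4 + 5 * 0))) :=
    tendsto_const_nhds.div (tendsto_const_nhds.add (tendsto_const_nhds.mul
      (tendsto_pow_atTop_nhds_zero_of_lt_one (by norm_num) (by norm_num)))) (by norm_num)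
  rw [mul_zero, add_zero] at h
  refine h.congr fun n => ?_
  rw [card_vertices_four, inv_pow]
  have : (0 : ℝ) < 10 ^ n := by positivity
  field_simp

end SierpinskiGasket

open SierpinskiGasket in
theorem proposition3 :
    ∃ z : ℝ, HasForestGrowthConstant (fun n => SierpinskiGasket.graph 4 n) z ∧
      (1.36051646575 : ℝ) ≤ z ∧ z < 1.36051646576 := by
  set a : ℕ → ℝ := fun n => Real.log ((∑ i, weights n i : ℕ) : ℝ) / 10 ^ n with ha
  -- The increasing sequence of `weights n 0` bounds `a` from below from stage three on; the upper
  -- bound comes from `a 3`, since `a` decreases to its infimum.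
  have hlow : ∀ n, 3 ≤ n → 1814.0219543334 / 10 ^ 3 ≤ a n := fun n hn => by
    refine le_trans ?_ ((monotone_log_weights_zero hn).trans (log_weights_zero_le n))
    exact div_le_div_of_nonneg_right le_log_weights_three (by positivity)
  have hbdd : BddBelow (Set.range a) := by
    refine ⟨0, ?_⟩
    rintro _ ⟨n, rfl⟩
    exact div_nonneg (Real.log_natCast_nonneg _) (by positivity)
  have hlim : Tendsto a atTop (𝓝 (⨅ n, a n)) :=
    tendsto_atTop_ciInf antitone_log_sum_weights hbdd
  have h1 : 1814.0219543334 / 10 ^ 3 ≤ ⨅ n, a n :=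
    ge_of_tendsto hlim (eventually_atTop.2 ⟨3, hlow⟩)
  have h2 : ⨅ n, a n ≤ 1814.0219543466 / 10 ^ 3 :=
    (ciInf_le hbdd 3).trans (div_le_div_of_nonneg_right log_sum_weights_three_le (by positivity))
  refine ⟨(⨅ n, a n) * (3 / 4), ⟨tendsto_card_vertices_four, ?_⟩, ?_, ?_⟩
  · refine (hlim.mul tendsto_pow_div_card).congr fun n => ?_
    rw [ha, numSpanningForests_graph]
    have : (0 : ℝ) < 10 ^ n := by positivity
    field_simp
  · norm_num at h1 ⊢
    linarith
  · norm_num at h2 ⊢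
    linarith
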